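/- Let $\Omega\subset\mathbb R^d$ be a bounded open convex set, $f\in C(\bar\Omega)$ with $f\ge c>0$ on $\Omega$, and let $u$ be the convex (Alexandroff) solution of $\det D^2u=f$ in $\Omega$, $u=0$ on $\partial\Omega$: $u\in C(\bar\Omega)$ is convex, $u=0$ on $\partial\Omega$, and $|\partial u(A)|=\int_A f$ for all Borel $A\subset\Omega$, where $\partial u$ is the subdifferential relative to $\Omega$ and $|\cdot|$ is Lebesgue measure. Assume $u\in C^{1,1}(\bar\Omega)$. For $h>0$, a nodal mesh of spacing $h$ consists of a finite set $\mathcal N_h^I\subset\Omega\cap(b+h\mathbb Z^d)$ of interior nodes ($b\in\mathbb R^d$) with $\mathrm{dist}(z,\partial\Omega)\ge h/2$ for $z\in\mathcal N_h^I$; a finite set $\mathcal N_h^B\subset\partial\Omega$ of boundary nodes such that every point of $\partial\Omega$ has distance at most $h$ to $\mathcal N_h^B$; and a simplicial triangulation $\mathcal T_h$ with vertex set $\mathcal N_h=\mathcal N_h^I\cup\mathcal N_h^B$, whose union is a neighbourhood of every interior node. It is shape regular with constant $\sigma$ if $h_T\le\sigma\rho_T$ for all $d$-simplices $T$ ($h_T$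 the diameter of $T$, $\rho_T$ that of its largest inscribed ball). Let $\phi_i$ be the piecewise linear hat function of $x_i\in\mathcal N_h^I$ (zero outside the simplices containing $x_i$ as a vertex) and $f_i=\int_\Omega f\phi_i\,dx$. For a nodal function $v:\mathcal N_h\to\mathbb R$ put $\partial v(x_i)=\{q\in\mathbb R^d: v(x_j)\ge v(x_i)+q\cdot(x_j-x_i)\ \forall x_j\in\mathcal N_h\}$; $v$ is convex if $\partial v(x_i)\ne\emptyset$ for all $x_i\in\mathcal N_h^I$. Let $N_hu=u|_{\mathcal N_h}$. A solution $u_h$ of the Oliker--Prussner method is a convex nodal function with $u_h=0$ on $\mathcal N_h^B$ and $|\partial u_h(x_i)|=f_i$ for all $x_i\in\mathcal N_h^I$. For $0\ne e\in\mathbb Z^d$ and $x_i\in\mathcal N_h^I$ let $$\delta_ev(x_i)=\frac{\rho_2v(x_i+\rho_1he)-(\rho_1+\rho_2)v(x_i)+\rho_1v(x_i-\rho_2he)}{\rho_1\rho_2(\rho_1+\rho_2)|e|^2h^2/2},$$ where $\rho_1=1$ if $x_i+he$ is a node, and otherwise $\rho_1$ is the largest $\rho>0$ with $x_i+\rho he\in\bar\Omega$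 (so $\rho_1\le1$ if $x_i+he\notin\Omega$); $\rho_2$ is defined likewise with $-e$; and $v$ is given the value $0$ at points of $\partial\Omega$ that are not nodes. Put $\|v\|_{W^2_p(\mathcal N_h^I)}=\big(\sum_{x_i\in\mathcal N_h^I}f_i|\delta_ev(x_i)|^p\big)^{1/p}$. Theorem. Let $1\le p<\infty$, $\sigma, C_0\in\mathbb R$. There are $C$ and $h_0>0$, depending only on $d,\Omega,f,u,p,\sigma,C_0$, such that for all $0<h<h_0$, every nodal mesh of spacing $h$ that is shape regular with constant $\sigma$ and satisfies $$\big||\partial N_hu(x_i)|-f_i\big|\le C_0h^{2+d}\qquad\text{for all }x_i\in\mathcal N_h^I,$$ every solution $u_h$ of the Oliker--Prussner method on it and every $0\ne e\in\mathbb Z^d$, $$\|N_hu-u_h\|_{W^2_p(\mathcal N_h^I)}\le\begin{cases}C\,h^2|\ln h| & \text{if }p=1,\\ C\,h^{2/p}&\text{if }p>1.\end{cases}$$ -/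

import Mathlib

open MeasureTheory
open scoped NNReal

noncomputable section

namespace OlikerPrussner

/-- Euclidean space `ℝᵈ`. -/
abbrev Pt (d : ℕ) : Type := EuclideanSpace ℝ (Fin d)

/-- The integer vector `k ∈ ℤᵈ` seen as a point of `ℝᵈ`. -/
def intVec {d : ℕ} (k : Fin d → ℤ) : Pt d := WithLp.toLp 2 (fun i => (k i : ℝ))

/-! ### The continuous problem -/

/-- The subdifferential at `x₀` of a function `u` given on `Ω`. -/
def subdiff {d : ℕ} (Ω : Set (Pt d)) (u : Pt d → ℝ) (x₀ : Pt d) : Set (Pt d) :=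
  {p | ∀ x ∈ Ω, u x₀ + inner ℝ p (x - x₀) ≤ u x}

/-- `u` is the (Alexandroff) convex solution of `det D²u = f` in `Ω`, `u = 0` on `∂Ω`:
`u ∈ C(Ω̄)` is convex, vanishes on `∂Ω`, and `|∂u(A)| = ∫_A f` for all Borel sets `A ⊆ Ω`. -/
structure IsMongeAmpereSolution {d : ℕ} (Ω : Set (Pt d)) (f u : Pt d → ℝ) : Prop where
  continuousOn : ContinuousOn u (closure Ω)
  convexOn : ConvexOn ℝ (closure Ω) u
  boundary : ∀ x ∈ frontier Ω, u x = 0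
  measure_eq : ∀ A : Set (Pt d), MeasurableSet A → A ⊆ Ω →
    volume (⋃ x ∈ A, subdiff Ω u x) = ∫⁻ x in A, ENNReal.ofReal (f x)

/-- `u ∈ C^{1,1}(Ω̄)` (for a convex open `Ω`): `u` is continuous on `Ω̄` and differentiable in `Ω`
with a Lipschitz continuous derivative. -/
def IsC11 {d : ℕ} (Ω : Set (Pt d)) (u : Pt d → ℝ) : Prop :=
  ContinuousOn u (closure Ω) ∧ DifferentiableOn ℝ u Ω ∧
    ∃ K : ℝ≥0, LipschitzOnWith K (fderiv ℝ u) Ω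

/-! ### Nodal sets and triangulations -/

/-- A translation invariant nodal set of spacing `h` for `Ω`, with an associated simplicial
triangulation whose vertices are exactly the nodes. -/
structure NodalMesh (d : ℕ) (Ω : Set (Pt d)) (h : ℝ) where
  /-- interior nodes -/
  interior : Finset (Pt d)
  /-- boundary nodes -/
  boundary : Finset (Pt d)
  /-- origin of the lattice -/
  base : Pt d
  /-- the triangulation -/
  tri : Geometry.SimplicialComplex ℝ (Pt d)
  interior_mem : ∀ z ∈ interior, z ∈ Ω
  boundary_mem : ∀ z ∈ boundary, z ∈ frontier Ω
  /-- interior nodes lie on the lattice `b + h ℤᵈ` -/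
  lattice : ∀ z ∈ interior, ∃ k : Fin d → ℤ, z = base + h • intVec k
  /-- interior nodes have distance at least `h / 2` to `∂Ω` -/
  dist_boundary : ∀ z ∈ interior, ∀ y ∈ frontier Ω, h / 2 ≤ dist z y
  /-- every point of `∂Ω` has distance at most `h` to the boundary nodes -/
  boundary_dense : ∀ x ∈ frontier Ω, ∃ z ∈ boundary, dist x z ≤ h
  vertices_eq : tri.vertices = ↑interior ∪ ↑boundary
  /-- the triangulated region is a neighbourhood of every interior node (so that the hat functions
  of interior nodes are continuous functions on `Ω̄`) -/
  covers : ∀ z ∈ interior, tri.space ∈ nhds z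

variable {d : ℕ} {Ω : Set (Pt d)} {h : ℝ}

/-- The set of all nodes. -/
def NodalMesh.nodes (M : NodalMesh d Ω h) : Set (Pt d) := ↑M.interior ∪ ↑M.boundary

/-- The diameter of the largest ball inscribed in `T`. -/
def inscribedDiam (T : Set (Pt d)) : ℝ :=
  sSup {t : ℝ | ∃ c : Pt d, Metric.ball c (t / 2) ⊆ T}

/-- Shape regularity `h_T / ρ_T ≤ σ` of all `d`-dimensional simplices of the triangulation. -/
def NodalMesh.ShapeRegular (M : NodalMesh d Ω h) (σ : ℝ) : Prop :=
  ∀ s ∈ M.tri.faces, s.card = d + 1 →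
    Metric.diam (convexHull ℝ (s : Set (Pt d))) ≤
      σ * inscribedDiam (convexHull ℝ (s : Set (Pt d)))

/-- The piecewise linear hat function of the vertex `z`: on a simplex that has `z` as a vertex it
is the barycentric coordinate belonging to `z`, elsewhere it is zero. (The set below has at most
one element, because simplices intersect in common faces, and `sSup ∅ = 0`.) -/
def hat (K : Geometry.SimplicialComplex ℝ (Pt d)) (z x : Pt d) : ℝ :=
  sSup {t : ℝ | ∃ s ∈ K.faces, z ∈ s ∧ ∃ w : Pt d → ℝ,
    (∀ y ∈ s, 0 ≤ w y) ∧ ∑ y ∈ s, w y = 1 ∧ ∑ y ∈ s, w y • y = x ∧ w z = t}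

/-- The nodal right-hand side `f_i = ∫_Ω f φ_i`. -/
def NodalMesh.load (M : NodalMesh d Ω h) (f : Pt d → ℝ) (z : Pt d) : ℝ :=
  ∫ x in Ω, f x * hat M.tri z x

/-! ### Nodal functions

A nodal function is represented by a function `v : ℝᵈ → ℝ`, of which only the values at the nodes
are ever used. -/

/-- The nodal interpolant `N_h v`. -/
def NodalMesh.interp (M : NodalMesh d Ω h) (v : Pt d → ℝ) : Pt d → ℝ :=
  M.nodes.indicator v

/-- The subdifferential `∂v(z)` of a nodal function at a node `z`. -/
def NodalMesh.subdiff (M : NodalMesh d Ω h) (v : Pt d → ℝ) (z : Pt d) : Set (Pt d) :=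
  {p | ∀ y ∈ M.nodes, v z + inner ℝ p (y - z) ≤ v y}

/-- A nodal function is convex if it has a supporting hyperplane at every interior node. -/
def NodalMesh.IsConvex (M : NodalMesh d Ω h) (v : Pt d → ℝ) : Prop :=
  ∀ z ∈ M.interior, (M.subdiff v z).Nonempty

/-- `v` is a solution of the Oliker-Prussner method: a convex nodal function with `v = 0` at the
boundary nodes and `|∂v(x_i)| = f_i` at the interior nodes. -/
structure NodalMesh.IsSolution (M : NodalMesh d Ω h) (f v : Pt d → ℝ) : Prop where
  convex : M.IsConvex v
  boundary : ∀ z ∈ M.boundary, v z = 0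
  measure_eq : ∀ z ∈ M.interior, volume (M.subdiff v z) = ENNReal.ofReal (M.load f z)

/-- The consistency error of `u` is at most `δ` at every interior node:
`| |∂N_h u(x_i)| - f_i | ≤ δ`. -/
def NodalMesh.ConsistencyLE (M : NodalMesh d Ω h) (f u : Pt d → ℝ) (δ : ℝ) : Prop :=
  ∀ z ∈ M.interior, volume (M.subdiff (M.interp u) z) ≠ ⊤ ∧
    |(volume (M.subdiff (M.interp u) z)).toReal - M.load f z| ≤ δ

open scoped Classical in
/-- The step length `ρ` from the node `x` in the direction `w`: `ρ = 1` if `x + w` is a node, and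
otherwise `x + ρ w` is the point where the ray from `x` leaves `Ω̄`. If `x + w` lies outside `Ω`,
this is the largest `ρ ∈ (0, 1]` with `x + ρ w ∈ Ω̄`. -/
def NodalMesh.step (M : NodalMesh d Ω h) (x w : Pt d) : ℝ :=
  if x + w ∈ M.nodes then 1 else sSup {t : ℝ | 0 < t ∧ x + t • w ∈ closure Ω}

open scoped Classical in
/-- The value of a nodal function at a node; at points of `∂Ω` that are not nodes the value is
given by the homogeneous Dirichlet condition. -/
def NodalMesh.value (M : NodalMesh d Ω h) (v : Pt d → ℝ) (y : Pt d) : ℝ :=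
  if y ∈ M.nodes then v y else 0

/-- The second order difference `δ_e v(x)`. For `ρ₁ = ρ₂ = 1` it is
`(v(x + he) - 2 v(x) + v(x - he)) / (|e|² h²)`. -/
def NodalMesh.secondDiff (M : NodalMesh d Ω h) (e : Fin d → ℤ) (v : Pt d → ℝ) (x : Pt d) : ℝ :=
  let w : Pt d := h • intVec e
  let ρ₁ : ℝ := M.step x w
  let ρ₂ : ℝ := M.step x (-w)
  (ρ₂ * M.value v (x + ρ₁ • w) - (ρ₁ + ρ₂) * M.value v x + ρ₁ * M.value v (x - ρ₂ • w)) /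
    (ρ₁ * ρ₂ * (ρ₁ + ρ₂) * ‖intVec e‖ ^ 2 * h ^ 2 / 2)

/-- The weighted discrete norm `‖v‖_{W²_p}` over the interior nodes, with respect to the direction
`e`. -/
def NodalMesh.w2pNorm (M : NodalMesh d Ω h) (f : Pt d → ℝ) (e : Fin d → ℤ) (p : ℝ)
    (v : Pt d → ℝ) : ℝ :=
  (∑ x ∈ M.interior, M.load f x * |M.secondDiff e v x| ^ p) ^ (1 / p)

end OlikerPrussner

end

namespace OlikerPrussner

/-! ### The Brunn–Minkowski inequality in multiplicative form -/

/-! Write U for the interpolant of u, v for the discrete solution, and weigh each interior node by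
f_i. The aim is a weak-type bound: for every t > 0, the nodes where |δ_e(U - v)| > t carry mass at
most C h²/t. Together with the uniform bound |δ_e(U - v)| ≤ C, a dyadic summation over levels gives
h²|ln h| for p = 1, where each of about |ln h| levels contributes h², and h² for the sum of p-th
powers when p > 1, where the levels form a geometric series.

Shape regularity gives f_i ≥ c₁ h^d, so the consistency hypothesis is a relative error of order h²
between the subdifferential measures. The comparison principle (`le_of_area_lt`) then yields U ≤ (1
- η) v and v ≤ (1 - η) U with η = κ h². In particular |U - v| = O(h²) at the nodes, and since both
arms of δ_e have length at least h/2, |δ_e(U - v)| is bounded uniformly in h and e.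

The weak-type bound comes from w = U - (1 - ε) v with η < ε < 1. Since U = ε (w/ε) + (1 - ε) v,
Brunn–Minkowski in the form |A|^ε |B|^(1-ε) ≤ |C| gives |∂w| ≤ ε^d e^(2η/ε) |∂v| at every interior
node (`area_sub_le`). Conversely w ≤ (ε - η) v, so monotonicity of subdifferentials makes the total
measure of ∂w at least (ε - η)^d times that of ∂v. Nodes with ∂w empty contribute nothing to this
total, hence their mass is O(η/ε) (`sum_nonContact_le`). At the other nodes w has a supporting
hyperplane, so δ_e w ≥ -Cε. As δ_e v is bounded above, δ_e(U - v) ≥ -Cε there; exchanging U and v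
gives the opposite inequality. Taking ε proportional to t finishes the weak-type bound.

"δ_e w ≥ -Cε" is not simply nonnegativity: δ_e may use the value 0 at boundary points that are not
nodes, where the supporting plane may be positive. The C^{1,1} bound up to the boundary, with u = 0
there and u < 0 somewhere inside, gives an interior touching ball at every boundary point
(`HasTangents.inner_le`). The plane therefore exceeds 0 by O(ε h²) only (`slope_bound`), an error
that survives division by h². -/

open scoped Pointwise in
/-- One-dimensional Brunn–Minkowski inequality for compact sets. -/
lemma volume_add_le_of_isCompact {S T U : Set ℝ} (hS : IsCompact S) (hT : IsCompact T)
    (hS0 : S.Nonempty) (hT0 : T.Nonempty) {a b : ℝ} (ha : 0 ≤ a) (hb : 0 ≤ b)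
    (hU : ∀ s ∈ S, ∀ t ∈ T, a * s + b * t ∈ U) :
    ENNReal.ofReal a * volume S + ENNReal.ofReal b * volume T ≤ volume U := by
  obtain ⟨s₀, hs₀, hs⟩ := hS.exists_isGreatest hS0
  obtain ⟨t₀, ht₀, ht⟩ := hT.exists_isLeast hT0
  -- With s₀ the maximum of S and t₀ the minimum of T, the translates P and Q lie on opposite sides
  -- of a s₀ + b t₀ and share only that point.
  set P : Set ℝ := (fun s => a * s + b * t₀) '' S with hP
  set Q : Set ℝ := (fun t => a * s₀ + b * t) '' T with hQ
  have hQm : MeasurableSet Q := (hT.image (by fun_prop)).measurableSet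
  have hvol : ∀ (r c : ℝ) (V : Set ℝ), 0 ≤ r →
      volume ((fun x => r * x + c) '' V) = ENNReal.ofReal r * volume V := by
    intro r c V hr
    have : (fun x => r * x + c) '' V = (fun x => x + c) '' (r • V) := by
      rw [← Set.image_smul, Set.image_image]; rfl
    rw [this, Set.image_add_right, measure_preimage_add_right, Measure.addHaar_smul]
    simp [abs_of_nonneg hr]
  have h1 : volume P = ENNReal.ofReal a * volume S := hvol a _ S ha
  have h2 : volume Q = ENNReal.ofReal b * volume T := by
    rw [← hvol b (a * s₀) T hb, hQ]; congr 2; ext t; ring_nf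
  have hd : AEDisjoint volume P Q := by
    refine measure_mono_null (t := {a * s₀ + b * t₀}) ?_ (by simp)
    rintro x ⟨⟨s, hs', rfl⟩, ⟨t, ht', h⟩⟩
    have e1 := mul_le_mul_of_nonneg_left (hs hs') ha
    have e2 := mul_le_mul_of_nonneg_left (ht ht') hb
    simp only [Set.mem_singleton_iff] at *
    linarith
  rw [← h1, ← h2, ← measure_union₀ hQm.nullMeasurableSet hd]
  apply measure_mono
  rintro x (⟨s, hs', rfl⟩ | ⟨t, ht', rfl⟩)
  · exact hU s hs' t₀ ht₀
  · exact hU s₀ hs₀ t ht'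

/-- One-dimensional Brunn–Minkowski inequality for measurable sets. -/
lemma volume_add_le_of_measurableSet {S T U : Set ℝ} (hS : MeasurableSet S) (hT : MeasurableSet T)
    (hS0 : S.Nonempty) (hT0 : T.Nonempty) {a b : ℝ} (ha : 0 ≤ a) (hb : 0 ≤ b)
    (hU : ∀ s ∈ S, ∀ t ∈ T, a * s + b * t ∈ U) :
    ENNReal.ofReal a * volume S + ENNReal.ofReal b * volume T ≤ volume U := by
  obtain ⟨s₀, hs₀⟩ := hS0
  obtain ⟨t₀, ht₀⟩ := hT0
  have key : ∀ K ⊆ S, IsCompact K → ∀ L ⊆ T, IsCompact L →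
      ENNReal.ofReal a * volume K + ENNReal.ofReal b * volume L ≤ volume U := by
    intro K hKS hK L hLT hL
    -- Inserting s₀ and t₀ keeps the compact sets nonempty, so that empty approximations are covered
    -- too.
    refine le_trans ?_ (volume_add_le_of_isCompact (hK.insert s₀) (hL.insert t₀) (by simp) (by simp)
      ha hb (U := U) fun s hs t ht => hU s ?_ t ?_)
    · gcongr <;> exact Set.subset_insert _ _
    · exact Set.insert_subset hs₀ hKS hs
    · exact Set.insert_subset ht₀ hLT ht
  have key2 : ∀ K ⊆ S, IsCompact K →
      ENNReal.ofReal a * volume K + ENNReal.ofReal b * volume T ≤ volume U := by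
    intro K hKS hK
    have hf : ENNReal.ofReal a * volume K ≠ ⊤ :=
      ENNReal.mul_ne_top ENNReal.ofReal_ne_top hK.measure_lt_top.ne
    rw [hT.measure_eq_iSup_isCompact, ENNReal.mul_iSup, add_comm]
    refine add_le_of_le_tsub_right_of_le ?_ (iSup_le fun L => ?_)
    · exact le_trans (by simp) (key K hKS hK ∅ (by simp) isCompact_empty)
    · simp only [ENNReal.mul_iSup]
      refine iSup_le fun hL => iSup_le fun hLc => ENNReal.le_sub_of_add_le_right hf ?_
      rw [add_comm]; exact key K hKS hK L hL hLc
  -- The passage to the supremum over K subtracts the T-term, which must be finite; if it is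
  -- infinite, K = ∅ already forces U to have infinite volume.
  rcases eq_or_ne (ENNReal.ofReal b * volume T) ⊤ with h | h
  · have := key2 ∅ (by simp) isCompact_empty
    rw [h] at this ⊢
    simpa using this
  · rw [hS.measure_eq_iSup_isCompact, ENNReal.mul_iSup]
    refine add_le_of_le_tsub_right_of_le ?_ (iSup_le fun L => ?_)
    · exact le_trans (by simp) (key2 ∅ (by simp) isCompact_empty)
    · simp only [ENNReal.mul_iSup]
      refine iSup_le fun hL => iSup_le fun hLc => ENNReal.le_sub_of_add_le_right h ?_
      exact key2 L hL hLc

/-- The one-dimensional Prékopa–Leindler inequality for functions with supremum `1`. -/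
lemma prekopaLeindler_normalized {F G H : ℝ → ℝ} (hF : Measurable F) (hG : Measurable G)
    (hH : Measurable H) (hF0 : ∀ x, 0 ≤ F x) (hG0 : ∀ x, 0 ≤ G x) (hH0 : ∀ x, 0 ≤ H x)
    (hF1 : ∀ x, F x ≤ 1) (hG1 : ∀ x, G x ≤ 1) (hFs : ∀ t < 1, ∃ x, t < F x)
    (hGs : ∀ t < 1, ∃ x, t < G x) {l : ℝ} (hl : 0 < l) (hl1 : l < 1)
    (h : ∀ s t, F s ^ l * G t ^ (1 - l) ≤ H (l * s + (1 - l) * t)) :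
    ENNReal.ofReal l * (∫⁻ x, ENNReal.ofReal (F x)) +
      ENNReal.ofReal (1 - l) * (∫⁻ x, ENNReal.ofReal (G x)) ≤ ∫⁻ x, ENNReal.ofReal (H x) := by
  rw [lintegral_eq_lintegral_meas_lt _ (.of_forall hF0) hF.aemeasurable,
    lintegral_eq_lintegral_meas_lt _ (.of_forall hG0) hG.aemeasurable,
    lintegral_eq_lintegral_meas_lt _ (.of_forall hH0) hH.aemeasurable,
    ← lintegral_const_mul' _ _ ENNReal.ofReal_ne_top,
    ← lintegral_const_mul' _ _ ENNReal.ofReal_ne_top, ← lintegral_add_left]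
  · refine setLIntegral_mono' measurableSet_Ioi fun t ht => ?_
    have ht0 : (0 : ℝ) < t := ht
    rcases lt_or_ge t 1 with ht1 | ht1
    · refine volume_add_le_of_measurableSet (hF measurableSet_Ioi) (hG measurableSet_Ioi)
        (hFs t ht1) (hGs t ht1) hl.le (by linarith) fun x hx y hy => ?_
      have hx : t < F x := hx
      have hy : t < G y := hy
      refine lt_of_lt_of_le ?_ (h x y)
      calc t = t ^ l * t ^ (1 - l) := by rw [← Real.rpow_add ht0]; simp
        _ < F x ^ l * G y ^ (1 - l) := by
          apply mul_lt_mul'' (Real.rpow_lt_rpow ht0.le hx hl)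
            (Real.rpow_lt_rpow ht0.le hy (by linarith)) <;> positivity
    · have e1 : {a | t < F a} = ∅ := by
        ext x; simpa using (hF1 x).trans ht1
      have e2 : {a | t < G a} = ∅ := by
        ext x; simpa using (hG1 x).trans ht1
      simp [e1, e2]
  · refine Measurable.const_mul (Antitone.measurable fun s t hst => ?_) _
    exact measure_mono fun x hx => lt_of_le_of_lt hst hx

/-- The one-dimensional Prékopa–Leindler inequality for bounded functions. -/
lemma prekopaLeindler {F G H : ℝ → ℝ} (hF : Measurable F) (hG : Measurable G)
    (hH : Measurable H) (hF0 : ∀ x, 0 ≤ F x) (hG0 : ∀ x, 0 ≤ G x) (hH0 : ∀ x, 0 ≤ H x)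
    (hFb : BddAbove (Set.range F)) (hGb : BddAbove (Set.range G))
    (hHf : ∫⁻ x, ENNReal.ofReal (H x) ≠ ⊤) {l : ℝ} (hl : 0 < l) (hl1 : l < 1)
    (h : ∀ s t, F s ^ l * G t ^ (1 - l) ≤ H (l * s + (1 - l) * t)) :
    (∫⁻ x, ENNReal.ofReal (F x)).toReal ^ l * (∫⁻ x, ENNReal.ofReal (G x)).toReal ^ (1 - l) ≤
      (∫⁻ x, ENNReal.ofReal (H x)).toReal := by
  set a := sSup (Set.range F)
  set b := sSup (Set.range G)
  have ha : ∀ x, F x ≤ a := fun x => le_csSup hFb ⟨x, rfl⟩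
  have hb : ∀ x, G x ≤ b := fun x => le_csSup hGb ⟨x, rfl⟩
  have hl' : 1 - l ≠ 0 := by linarith
  rcases ((hF0 0).trans (ha 0)).eq_or_lt with ha0 | ha0
  · have : ∀ x, F x = 0 := fun x => le_antisymm ((ha x).trans ha0.ge) (hF0 x)
    simp [this, Real.zero_rpow hl.ne']
  rcases ((hG0 0).trans (hb 0)).eq_or_lt with hb0 | hb0
  · have : ∀ x, G x = 0 := fun x => le_antisymm ((hb x).trans hb0.ge) (hG0 x)
    simp [this, Real.zero_rpow hl']
  set c := a ^ l * b ^ (1 - l) with hc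
  have hc0 : 0 < c := by positivity
  have key := prekopaLeindler_normalized (F := fun x => a⁻¹ * F x) (G := fun x => b⁻¹ * G x)
    (H := fun x => c⁻¹ * H x) (by fun_prop) (by fun_prop) (by fun_prop)
    (fun x => mul_nonneg (by positivity) (hF0 x)) (fun x => mul_nonneg (by positivity) (hG0 x))
    (fun x => mul_nonneg (by positivity) (hH0 x))
    (fun x => by rw [inv_mul_le_iff₀ ha0]; simpa using ha x)
    (fun x => by rw [inv_mul_le_iff₀ hb0]; simpa using hb x)
    (fun t ht => by
      obtain ⟨_, ⟨x, rfl⟩, hx⟩ := exists_lt_of_lt_csSup (Set.range_nonempty F)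
        (show t * a < a by nlinarith)
      exact ⟨x, by rw [lt_inv_mul_iff₀ ha0, mul_comm]; exact hx⟩)
    (fun t ht => by
      obtain ⟨_, ⟨x, rfl⟩, hx⟩ := exists_lt_of_lt_csSup (Set.range_nonempty G)
        (show t * b < b by nlinarith)
      exact ⟨x, by rw [lt_inv_mul_iff₀ hb0, mul_comm]; exact hx⟩) hl hl1
    (fun s t => by
      rw [Real.mul_rpow (by positivity) (hF0 s), Real.mul_rpow (by positivity) (hG0 t),
        Real.inv_rpow ha0.le, Real.inv_rpow hb0.le, hc, mul_inv]
      calc _ = (a ^ l)⁻¹ * (b ^ (1 - l))⁻¹ * (F s ^ l * G t ^ (1 - l)) := by ring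
        _ ≤ _ := by gcongr; exact h s t)
  have hm : ∀ (r : ℝ) (f : ℝ → ℝ), 0 ≤ r → ∫⁻ x, ENNReal.ofReal (r * f x) =
      ENNReal.ofReal r * ∫⁻ x, ENNReal.ofReal (f x) := by
    intro r f hr
    rw [← lintegral_const_mul' _ _ ENNReal.ofReal_ne_top]
    simp_rw [ENNReal.ofReal_mul hr]
  rw [hm _ _ (by positivity), hm _ _ (by positivity), hm _ _ (by positivity)] at key
  set IF := ∫⁻ x, ENNReal.ofReal (F x)
  set IG := ∫⁻ x, ENNReal.ofReal (G x)
  set IH := ∫⁻ x, ENNReal.ofReal (H x)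
  have hRt : ENNReal.ofReal c⁻¹ * IH ≠ ⊤ := ENNReal.mul_ne_top ENNReal.ofReal_ne_top hHf
  have key' := ENNReal.toReal_mono hRt key
  have hLt := ne_top_of_le_ne_top hRt key
  rw [ENNReal.add_ne_top] at hLt
  rw [ENNReal.toReal_add hLt.1 hLt.2] at key'
  simp only [ENNReal.toReal_mul, ENNReal.toReal_ofReal hl.le,
    ENNReal.toReal_ofReal (show 0 ≤ 1 - l by linarith),
    ENNReal.toReal_ofReal (inv_nonneg.2 ha0.le), ENNReal.toReal_ofReal (inv_nonneg.2 hb0.le),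
    ENNReal.toReal_ofReal (inv_nonneg.2 hc0.le)] at key'
  -- After normalization by the suprema the additive bound holds; the weighted AM–GM inequality
  -- makes it multiplicative, and the factors a^l b^(1-l) cancel.
  have amgm := Real.geom_mean_le_arith_mean2_weighted hl.le (show 0 ≤ 1 - l by linarith)
    (show 0 ≤ a⁻¹ * IF.toReal by positivity) (show 0 ≤ b⁻¹ * IG.toReal by positivity) (by ring)
  have fin := amgm.trans key'
  rw [Real.mul_rpow (by positivity) (by positivity), Real.mul_rpow (by positivity) (by positivity),
    Real.inv_rpow ha0.le, Real.inv_rpow hb0.le] at fin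
  have e : (a ^ l)⁻¹ * IF.toReal ^ l * ((b ^ (1 - l))⁻¹ * IG.toReal ^ (1 - l)) =
      c⁻¹ * (IF.toReal ^ l * IG.toReal ^ (1 - l)) := by rw [hc, mul_inv]; ring
  rw [e] at fin
  exact le_of_mul_le_mul_left fin (by positivity)

lemma preimage_mk_preimage_piFinSuccAbove_symm {n : ℕ} (A : Set (Fin (n + 1) → ℝ)) (s : ℝ) :
    Prod.mk s ⁻¹' ((MeasurableEquiv.piFinSuccAbove (fun _ : Fin (n + 1) => ℝ) 0).symm ⁻¹' A) =
      {y : Fin n → ℝ | Fin.cons s y ∈ A} := by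
  ext y
  simp only [MeasurableEquiv.piFinSuccAbove, Fin.insertNthEquiv_zero]
  exact Iff.rfl

lemma volume_eq_lintegral_slices {n : ℕ} {A : Set (Fin (n + 1) → ℝ)} (hA : MeasurableSet A) :
    volume A = ∫⁻ s : ℝ, volume {y : Fin n → ℝ | Fin.cons s y ∈ A} := by
  have h := (volume_preserving_piFinSuccAbove (fun _ : Fin (n + 1) => ℝ) 0).symm
  rw [← h.measure_preimage hA.nullMeasurableSet, Measure.volume_eq_prod,
    Measure.prod_apply (h.measurable hA)]
  simp_rw [preimage_mk_preimage_piFinSuccAbove_symm]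

lemma measurable_volume_slices {n : ℕ} {A : Set (Fin (n + 1) → ℝ)} (hA : MeasurableSet A) :
    Measurable fun s : ℝ => volume {y : Fin n → ℝ | Fin.cons s y ∈ A} := by
  have h := (volume_preserving_piFinSuccAbove (fun _ : Fin (n + 1) => ℝ) 0).symm
  have := measurable_measure_prodMk_left (ν := (volume : Measure (Fin n → ℝ))) (h.measurable hA)
  simpa only [preimage_mk_preimage_piFinSuccAbove_symm] using this

lemma slice_subset_image_tail {n : ℕ} (A : Set (Fin (n + 1) → ℝ)) (s : ℝ) :
    {y : Fin n → ℝ | Fin.cons s y ∈ A} ⊆ (fun x => Fin.tail x) '' A :=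
  fun y hy => ⟨Fin.cons s y, hy, Fin.tail_cons _ _⟩

lemma isCompact_slice {n : ℕ} {A : Set (Fin (n + 1) → ℝ)} (hA : IsCompact A) (s : ℝ) :
    IsCompact {y : Fin n → ℝ | Fin.cons s y ∈ A} := by
  refine (hA.image (f := fun x => Fin.tail x) ?_).of_isClosed_subset ?_
    (slice_subset_image_tail A s)
  · exact continuous_pi fun i => continuous_apply _
  · exact hA.isClosed.preimage (continuous_pi fun i => by
      refine Fin.cases ?_ (fun j => ?_) i <;> simp <;> fun_prop)

/-- Induction on the dimension: by the inductive hypothesis the slice volumes satisfy the hypothesis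
of one-dimensional Prékopa–Leindler, and Fubini recovers the volumes. The multiplicative form has no
dimension-dependent exponent, so it reproduces itself. -/
lemma brunnMinkowski_pi (n : ℕ) : ∀ {A B C : Set (Fin n → ℝ)}, IsCompact A → IsCompact B →
    IsCompact C → ∀ {l : ℝ}, 0 < l → l < 1 → (∀ a ∈ A, ∀ b ∈ B, l • a + (1 - l) • b ∈ C) →
    (volume A).toReal ^ l * (volume B).toReal ^ (1 - l) ≤ (volume C).toReal := by
  induction n with
  | zero =>
    intro A B C hA hB hC l hl hl1 h
    rcases A.eq_empty_or_nonempty with rfl | ⟨a, ha⟩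
    · simp [Real.zero_rpow hl.ne']
    rcases B.eq_empty_or_nonempty with rfl | ⟨b, hb⟩
    · simp [Real.zero_rpow (show 1 - l ≠ 0 by linarith)]
    have e : ∀ S : Set (Fin 0 → ℝ), ∀ a ∈ S, S = Set.univ := fun S a ha =>
      Set.eq_univ_of_forall fun x => Subsingleton.elim a x ▸ ha
    rw [e A a ha, e B b hb, e C _ (h a ha b hb)]
    simp [volume_pi]
  | succ n ih =>
    intro A B C hA hB hC l hl hl1 h
    have hfin : ∀ {S : Set (Fin (n + 1) → ℝ)}, IsCompact S → ∀ s,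
        volume {y : Fin n → ℝ | Fin.cons s y ∈ S} ≠ ⊤ :=
      fun hS s => (isCompact_slice hS s).measure_lt_top.ne
    have hvol : ∀ {S : Set (Fin (n + 1) → ℝ)}, IsCompact S → volume S =
        ∫⁻ s, ENNReal.ofReal (volume {y : Fin n → ℝ | Fin.cons s y ∈ S}).toReal := by
      intro S hS
      simp_rw [ENNReal.ofReal_toReal (hfin hS _)]
      exact volume_eq_lintegral_slices hS.measurableSet
    have hbdd : ∀ {S : Set (Fin (n + 1) → ℝ)}, IsCompact S → BddAbove (Set.range fun s =>
        (volume {y : Fin n → ℝ | Fin.cons s y ∈ S}).toReal) := by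
      intro S hS
      refine ⟨(volume ((fun x => Fin.tail x) '' S)).toReal, ?_⟩
      rintro _ ⟨s, rfl⟩
      refine ENNReal.toReal_mono ?_ (measure_mono (slice_subset_image_tail S s))
      exact (hS.image (continuous_pi fun i => continuous_apply _)).measure_lt_top.ne
    have hmeas : ∀ {S : Set (Fin (n + 1) → ℝ)}, IsCompact S → Measurable fun s =>
        (volume {y : Fin n → ℝ | Fin.cons s y ∈ S}).toReal := fun hS =>
      (measurable_volume_slices hS.measurableSet).ennreal_toReal
    rw [hvol hA, hvol hB, hvol hC]
    refine prekopaLeindler (hmeas hA) (hmeas hB) (hmeas hC) (fun _ => ENNReal.toReal_nonneg)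
      (fun _ => ENNReal.toReal_nonneg) (fun _ => ENNReal.toReal_nonneg) (hbdd hA) (hbdd hB)
      (by rw [← hvol hC]; exact hC.measure_lt_top.ne) hl hl1 fun s t => ?_
    refine ih (isCompact_slice hA s) (isCompact_slice hB t) (isCompact_slice hC _) hl hl1
      fun a ha b hb => ?_
    have := h _ ha _ hb
    simp only [Set.mem_ofPred_eq]
    convert this using 1
    ext i
    refine Fin.cases ?_ (fun j => ?_) i <;> simp

/-- The Brunn–Minkowski inequality in multiplicative form. -/
lemma brunnMinkowski {d : ℕ} {A B C : Set (Pt d)} (hA : IsCompact A) (hB : IsCompact B)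
    (hC : IsCompact C) {l : ℝ} (hl : 0 < l) (hl1 : l < 1)
    (h : ∀ a ∈ A, ∀ b ∈ B, l • a + (1 - l) • b ∈ C) :
    (volume A).toReal ^ l * (volume B).toReal ^ (1 - l) ≤ (volume C).toReal := by
  have key : ∀ {S : Set (Pt d)}, IsCompact S → IsCompact (WithLp.toLp 2 ⁻¹' S) ∧
      volume (WithLp.toLp 2 ⁻¹' S : Set (Fin d → ℝ)) = volume S := by
    intro S hS
    refine ⟨(PiLp.homeomorph 2 (fun _ : Fin d => ℝ)).symm.isCompact_preimage.2 hS, ?_⟩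
    exact (PiLp.volume_preserving_toLp (Fin d)).measure_preimage hS.measurableSet.nullMeasurableSet
  rw [← (key hA).2, ← (key hB).2, ← (key hC).2]
  refine brunnMinkowski_pi d (key hA).1 (key hB).1 (key hC).1 hl hl1 fun a ha b hb => ?_
  exact h _ ha _ hb

end OlikerPrussner

namespace OlikerPrussner

/-! ### Hat functions and the nodal right-hand side -/

section Hat

variable {d : ℕ} (K : Geometry.SimplicialComplex ℝ (Pt d)) (z x : Pt d)

lemma mem_Icc_of_mem_hat_set {t : ℝ} (ht : t ∈ {t : ℝ | ∃ s ∈ K.faces, z ∈ s ∧ ∃ w : Pt d → ℝ,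
    (∀ y ∈ s, 0 ≤ w y) ∧ ∑ y ∈ s, w y = 1 ∧ ∑ y ∈ s, w y • y = x ∧ w z = t}) :
    0 ≤ t ∧ t ≤ 1 := by
  obtain ⟨s, -, hz, w, hw, hs, -, rfl⟩ := ht
  exact ⟨hw z hz, hs ▸ Finset.single_le_sum hw hz⟩

lemma hat_nonneg : 0 ≤ hat K z x :=
  Real.sSup_nonneg fun _ ht => (mem_Icc_of_mem_hat_set K z x ht).1

lemma hat_le_one : hat K z x ≤ 1 :=
  Real.sSup_le (fun _ ht => (mem_Icc_of_mem_hat_set K z x ht).2) zero_le_one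

variable {K z x} in
lemma le_hat {s : Finset (Pt d)} (hs : s ∈ K.faces) (hz : z ∈ s) {w : Pt d → ℝ}
    (hw : ∀ y ∈ s, 0 ≤ w y) (hw1 : ∑ y ∈ s, w y = 1) (hx : ∑ y ∈ s, w y • y = x) :
    w z ≤ hat K z x :=
  le_csSup ⟨1, fun _ ht => (mem_Icc_of_mem_hat_set K z x ht).2⟩ ⟨s, hs, hz, w, hw, hw1, hx, rfl⟩

lemma lt_hat_iff {t : ℝ} (ht : 0 ≤ t) : t < hat K z x ↔ ∃ s ∈ K.faces, z ∈ s ∧ ∃ w : Pt d → ℝ,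
    (∀ y ∈ s, 0 ≤ w y) ∧ ∑ y ∈ s, w y = 1 ∧ ∑ y ∈ s, w y • y = x ∧ t < w z := by
  constructor
  · intro h
    have hne : {t : ℝ | ∃ s ∈ K.faces, z ∈ s ∧ ∃ w : Pt d → ℝ, (∀ y ∈ s, 0 ≤ w y) ∧
        ∑ y ∈ s, w y = 1 ∧ ∑ y ∈ s, w y • y = x ∧ w z = t}.Nonempty := by
      by_contra hne
      rw [Set.not_nonempty_iff_eq_empty] at hne
      rw [hat, hne, Real.sSup_empty] at h
      linarith
    obtain ⟨_, ⟨s, hs, hz, w, hw, hw1, hx, rfl⟩, htw⟩ := exists_lt_of_lt_csSup hne h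
    exact ⟨s, hs, hz, w, hw, hw1, hx, htw⟩
  · rintro ⟨s, hs, hz, w, hw, hw1, hx, htw⟩
    exact htw.trans_le (le_hat hs hz hw hw1 hx)

/-- Each superlevel set at t ≥ 0 is a finite union of convex sets, one per face, and convex sets are
null measurable. -/
lemma aemeasurable_hat (hK : K.faces.Finite) : AEMeasurable (hat K z) := by
  suffices hmain : ∀ t, NullMeasurableSet (hat K z ⁻¹' Set.Ioi t) from
    NullMeasurable.aemeasurable (f := hat K z) (μ := volume)
      (measurable_of_Ioi (α := ℝ) (δ := NullMeasurableSpace (Pt d) volume) hmain)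
  intro t
  rcases lt_or_ge t 0 with ht | ht
  · convert nullMeasurableSet_univ
    exact Set.eq_univ_of_forall fun x => ht.trans_le (hat_nonneg K z x)
  · have : hat K z ⁻¹' Set.Ioi t = ⋃ s ∈ K.faces, {x | z ∈ s ∧ ∃ w : Pt d → ℝ,
        (∀ y ∈ s, 0 ≤ w y) ∧ ∑ y ∈ s, w y = 1 ∧ ∑ y ∈ s, w y • y = x ∧ t < w z} := by
      ext x
      simp only [Set.mem_preimage, Set.mem_Ioi, lt_hat_iff K z x ht, Set.mem_iUnion, exists_prop]
      rfl
    rw [this]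
    refine NullMeasurableSet.biUnion hK.countable fun s _ => ?_
    refine Convex.nullMeasurableSet (E := Pt d) (μ := volume) ?_
    rintro x ⟨hz, w, hw, hw1, rfl, hwt⟩ y ⟨-, w', hw', hw1', rfl, hwt'⟩ a b ha hb hab
    refine ⟨hz, fun p => a * w p + b * w' p, fun p hp => ?_, ?_, ?_, ?_⟩
    · have := hw p hp
      have := hw' p hp
      positivity
    · rw [Finset.sum_add_distrib, ← Finset.mul_sum, ← Finset.mul_sum, hw1, hw1']
      linarith
    · simp only [add_smul, Finset.sum_add_distrib, Finset.smul_sum, mul_smul]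
    · rcases ha.eq_or_lt with rfl | ha
      · obtain rfl : b = 1 := by linarith
        simpa using hwt'
      · have e1 := mul_lt_mul_of_pos_left hwt ha
        have e2 := mul_le_mul_of_nonneg_left hwt'.le hb
        calc t = a * t + b * t := by rw [← add_mul, hab, one_mul]
          _ < _ := by linarith

/-- Contracting towards z by one half changes the barycentric coordinate t of z into (1 + t)/2. -/
lemma half_le_hat {s : Finset (Pt d)} (hs : s ∈ K.faces) (hz : z ∈ s)
    (hx : x ∈ AffineMap.homothety z (1 / 2 : ℝ) '' convexHull ℝ (s : Set (Pt d))) :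
    1 / 2 ≤ hat K z x := by
  classical
  obtain ⟨b, hb, rfl⟩ := hx
  obtain ⟨w, hw, hw1, hwb⟩ := Finset.mem_convexHull.1 hb
  rw [Finset.centerMass_eq_of_sum_1 _ _ hw1] at hwb
  have hle := le_hat (w := fun y => 1 / 2 * w y + if y = z then 1 / 2 else 0) hs hz
    (x := AffineMap.homothety z (1 / 2 : ℝ) b) ?_ ?_ ?_
  · have := hw z hz
    simp only [if_true] at hle
    linarith
  · intro y hy
    have := hw y hy
    positivity
  · rw [Finset.sum_add_distrib, ← Finset.mul_sum, hw1]
    simp [hz]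
    norm_num
  · simp only [add_smul, Finset.sum_add_distrib, mul_smul, ← Finset.smul_sum]
    simp only [id] at hwb
    rw [hwb]
    simp only [ite_smul, zero_smul, Finset.sum_ite_eq', hz, if_true, AffineMap.homothety_apply,
      vsub_eq_sub, vadd_eq_add]
    module

end Hat

variable {d : ℕ} {Ω : Set (Pt d)} {h : ℝ}

lemma NodalMesh.mem_nodes_of_mem_face (M : NodalMesh d Ω h) {s : Finset (Pt d)}
    (hs : s ∈ M.tri.faces) {y : Pt d} (hy : y ∈ s) : y ∈ M.nodes := by
  have : y ∈ M.tri.vertices :=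
    M.tri.down_closed hs (Finset.singleton_subset_iff.2 hy) (Finset.singleton_nonempty y)
  rwa [M.vertices_eq] at this

lemma NodalMesh.finite_nodes (M : NodalMesh d Ω h) : M.nodes.Finite :=
  M.interior.finite_toSet.union M.boundary.finite_toSet

lemma NodalMesh.finite_faces (M : NodalMesh d Ω h) : M.tri.faces.Finite := by
  refine (M.finite_nodes.toFinset.powerset.finite_toSet).subset fun s hs => ?_
  simp only [Finset.coe_powerset, Set.mem_preimage, Set.mem_powerset_iff, Set.Finite.coe_toFinset]
  exact fun y hy => M.mem_nodes_of_mem_face hs hy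

lemma NodalMesh.nodes_subset_closure (M : NodalMesh d Ω h) : M.nodes ⊆ closure Ω := by
  rintro y (hy | hy)
  · exact subset_closure (M.interior_mem y hy)
  · exact frontier_subset_closure (M.boundary_mem y hy)

lemma NodalMesh.convexHull_subset_closure (M : NodalMesh d Ω h) (hΩc : Convex ℝ Ω)
    {s : Finset (Pt d)} (hs : s ∈ M.tri.faces) :
    convexHull ℝ (s : Set (Pt d)) ⊆ closure Ω :=
  convexHull_min (fun _ hy => M.nodes_subset_closure (M.mem_nodes_of_mem_face hs hy)) hΩc.closure

lemma one_le_norm_intVec {k : Fin d → ℤ} (hk : k ≠ 0) : 1 ≤ ‖intVec k‖ := by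
  obtain ⟨i, hi⟩ := Function.ne_iff.1 hk
  refine le_trans ?_ (PiLp.norm_apply_le (intVec k) i)
  simp only [intVec, Real.norm_eq_abs]
  exact_mod_cast Int.one_le_abs hi

lemma NodalMesh.half_le_dist (M : NodalMesh d Ω h) (hh : 0 < h) {z y : Pt d} (hz : z ∈ M.interior)
    (hy : y ∈ M.nodes) (hzy : z ≠ y) : h / 2 ≤ dist z y := by
  rcases hy with hy | hy
  · obtain ⟨k, rfl⟩ := M.lattice z hz
    obtain ⟨l, rfl⟩ := M.lattice y hy
    have hkl : k - l ≠ 0 := by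
      rw [sub_ne_zero]
      rintro rfl
      exact hzy rfl
    have e : intVec k - intVec l = intVec (k - l) := by
      ext i; simp [intVec]
    rw [dist_add_left, dist_eq_norm, ← smul_sub, e, norm_smul, Real.norm_eq_abs, abs_of_pos hh]
    nlinarith [one_le_norm_intVec hkl]
  · exact M.dist_boundary z hz y (M.boundary_mem y hy)

/-- Every interior node is a vertex of a full-dimensional simplex. -/
lemma NodalMesh.exists_simplex (M : NodalMesh d Ω h) {z : Pt d} (hz : z ∈ M.interior) :
    ∃ s ∈ M.tri.faces, z ∈ s ∧ s.card = d + 1 := by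
  have hzv : z ∈ M.tri.vertices := by rw [M.vertices_eq]; exact Or.inl hz
  -- Z is closed and misses z, so the faces having z as a vertex cover a neighbourhood of z. Were
  -- none full-dimensional, that neighbourhood would be null.
  set Z : Set (Pt d) := ⋃ s ∈ {s ∈ M.tri.faces | z ∉ s}, convexHull ℝ (s : Set (Pt d))
  have hZ : IsClosed Z := (M.finite_faces.subset (fun s hs => hs.1)).isClosed_biUnion
    fun s _ => (s.finite_toSet.isCompact_convexHull ℝ).isClosed
  have hzZ : z ∉ Z := by
    simp only [Z, Set.mem_iUnion, not_exists]
    rintro s ⟨hs, hzs⟩ hzs'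
    exact hzs ((M.tri.vertex_mem_convexHull_iff hzv hs).1 hzs')
  have hnhds := Filter.inter_mem (M.covers z hz) (hZ.isOpen_compl.mem_nhds hzZ)
  by_contra! hcon
  refine (Measure.measure_pos_of_mem_nhds volume hnhds).ne' ?_
  refine measure_mono_null (t := ⋃ s ∈ {s ∈ M.tri.faces | z ∈ s}, convexHull ℝ (s : Set (Pt d)))
    ?_ ?_
  · rintro x ⟨hx, hxZ⟩
    obtain ⟨s, hs, hxs⟩ := Geometry.SimplicialComplex.mem_space_iff.1 hx
    refine Set.mem_biUnion (x := s) ⟨hs, ?_⟩ hxs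
    by_contra hzs
    exact hxZ (Set.mem_biUnion (x := s) ⟨hs, hzs⟩ hxs)
  · rw [measure_biUnion_null_iff (M.finite_faces.subset fun s hs => hs.1).countable]
    rintro s ⟨hs, hzs⟩
    refine measure_mono_null (convexHull_subset_affineSpan _) (Measure.addHaar_affineSubspace _ _ ?_)
    intro htop
    have := (M.tri.indep hs).affineSpan_eq_top_iff_card_eq_finrank_add_one
    simp only [Subtype.range_coe_subtype, finrank_euclideanSpace, Fintype.card_coe,
      Fintype.card_fin] at this
    exact hcon s hs hzs (this.1 htop)

lemma interior_closure_eq_of_convex (hΩo : IsOpen Ω) (hΩc : Convex ℝ Ω) (hne : Ω.Nonempty) :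
    interior (closure Ω) = Ω := by
  rw [hΩc.interior_closure_eq_interior_of_nonempty_interior (by rwa [hΩo.interior_eq]),
    hΩo.interior_eq]

lemma homothety_half_ball (z c : Pt d) (r : ℝ) :
    Metric.ball (AffineMap.homothety z (1 / 2 : ℝ) c) (r / 2) ⊆
      AffineMap.homothety z (1 / 2 : ℝ) '' Metric.ball c r := by
  intro x hx
  refine ⟨z + (2 : ℝ) • (x - z), ?_, ?_⟩
  · rw [Metric.mem_ball, dist_eq_norm] at *
    have : z + (2 : ℝ) • (x - z) - c = (2 : ℝ) • (x - AffineMap.homothety z (1 / 2 : ℝ) c) := by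
      simp only [AffineMap.homothety_apply, vsub_eq_sub, vadd_eq_add]
      module
    rw [this, norm_smul]
    simp
    linarith
  · simp only [AffineMap.homothety_apply, vsub_eq_sub, vadd_eq_add]
    module

/-- The hat function of an interior node is at least `1 / 2` on a ball of radius comparable to the
mesh size. -/
lemma NodalMesh.exists_ball_half_le_hat (M : NodalMesh d Ω h) (hd : d ≠ 0) (hh : 0 < h)
    (hΩo : IsOpen Ω) (hΩc : Convex ℝ Ω) {σ : ℝ} (hσ : 1 ≤ σ) (hM : M.ShapeRegular σ)
    {z : Pt d} (hz : z ∈ M.interior) :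
    ∃ c, Metric.ball c (h / (16 * σ)) ⊆ Ω ∧
      ∀ x ∈ Metric.ball c (h / (16 * σ)), 1 / 2 ≤ hat M.tri z x := by
  obtain ⟨s, hs, hzs, hcard⟩ := M.exists_simplex hz
  obtain ⟨y, hys, hyz⟩ := Finset.exists_mem_ne (by omega : 1 < s.card) z
  have hcomp := s.finite_toSet.isCompact_convexHull ℝ
  have h1 : h / 2 ≤ Metric.diam (convexHull ℝ (s : Set (Pt d))) :=
    (M.half_le_dist hh hz (M.mem_nodes_of_mem_face hs hys) hyz.symm).trans
      (Metric.dist_le_diam_of_mem hcomp.isBounded (subset_convexHull ℝ _ hzs)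
        (subset_convexHull ℝ _ hys))
  -- The true bound is h/(2σ); the smaller one is strict, so some inscribed ball has diameter t
  -- above it. Its radius t/2 is halved by the contraction to z, whence h/(16σ).
  have h2 : h / (4 * σ) < inscribedDiam (convexHull ℝ (s : Set (Pt d))) := by
    have := h1.trans (hM s hs hcard)
    have h3 : h / 2 / σ ≤ inscribedDiam (convexHull ℝ (s : Set (Pt d))) := by
      rw [div_le_iff₀ (by linarith)]; linarith
    refine lt_of_lt_of_le ?_ h3
    rw [div_div]
    gcongr
    norm_num
  obtain ⟨t, ⟨c, hc⟩, ht⟩ := exists_lt_of_lt_csSup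
    (s := {t : ℝ | ∃ c : Pt d, Metric.ball c (t / 2) ⊆ convexHull ℝ (s : Set (Pt d))})
    ⟨0, z, by simp⟩ h2
  have hsub : Metric.ball (AffineMap.homothety z (1 / 2 : ℝ) c) (h / (16 * σ)) ⊆
      AffineMap.homothety z (1 / 2 : ℝ) '' convexHull ℝ (s : Set (Pt d)) := by
    refine (Metric.ball_subset_ball ?_).trans
      ((homothety_half_ball z c (t / 2)).trans (Set.image_mono hc))
    have : h / (16 * σ) = h / (4 * σ) / 4 := by rw [div_div]; ring
    linarith
  refine ⟨_, ?_, fun x hx => half_le_hat _ _ _ hs hzs (hsub hx)⟩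
  rw [← interior_closure_eq_of_convex hΩo hΩc ⟨z, M.interior_mem z hz⟩]
  refine interior_maximal (hsub.trans ?_) Metric.isOpen_ball
  rintro _ ⟨x, hx, rfl⟩
  have hcl := (convex_convexHull ℝ (s : Set (Pt d)))
  refine M.convexHull_subset_closure hΩc hs ?_
  rw [AffineMap.homothety_eq_lineMap]
  exact hcl.lineMap_mem (subset_convexHull ℝ _ hzs) hx ⟨by norm_num, by norm_num⟩

lemma NodalMesh.integrableOn_mul_hat (M : NodalMesh d Ω h) (hΩb : Bornology.IsBounded Ω) {f : Pt d → ℝ} (hf : ContinuousOn f (closure Ω)) (z : Pt d) :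
    IntegrableOn (fun x => f x * hat M.tri z x) Ω := by
  have hfi : IntegrableOn f Ω :=
    (hf.integrableOn_compact hΩb.isCompact_closure).mono_set subset_closure
  refine Integrable.mul_bdd (c := 1) hfi
    (aemeasurable_hat M.tri z M.finite_faces).aestronglyMeasurable.restrict ?_
  exact .of_forall fun x => by
    rw [Real.norm_eq_abs, abs_of_nonneg (hat_nonneg _ _ _)]; exact hat_le_one _ _ _

/-- The nodal right-hand sides are bounded below by a multiple of `h ^ d`. -/
lemma NodalMesh.le_load (M : NodalMesh d Ω h) (hd : d ≠ 0) (hh : 0 < h)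
    (hΩo : IsOpen Ω) (hΩb : Bornology.IsBounded Ω) (hΩc : Convex ℝ Ω) {σ : ℝ} (hσ : 1 ≤ σ)
    (hM : M.ShapeRegular σ) {f : Pt d → ℝ} (hf : ContinuousOn f (closure Ω)) {c : ℝ} (hc : 0 ≤ c)
    (hfc : ∀ x ∈ Ω, c ≤ f x) {z : Pt d} (hz : z ∈ M.interior) :
    c / 2 * (volume (Metric.ball (0 : Pt d) 1)).toReal / (16 * σ) ^ d * h ^ d ≤ M.load f z := by
  obtain ⟨b, hbΩ, hb⟩ := M.exists_ball_half_le_hat hd hh hΩo hΩc hσ hM hz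
  have : Nonempty (Fin d) := ⟨⟨0, Nat.pos_of_ne_zero hd⟩⟩
  have hint := M.integrableOn_mul_hat hΩb hf z
  have hvol : (volume (Metric.ball b (h / (16 * σ)))).toReal =
      (h / (16 * σ)) ^ d * (volume (Metric.ball (0 : Pt d) 1)).toReal := by
    rw [Measure.addHaar_ball _ _ (by positivity), ENNReal.toReal_mul, finrank_euclideanSpace,
      Fintype.card_fin, ENNReal.toReal_ofReal (by positivity)]
  calc c / 2 * (volume (Metric.ball (0 : Pt d) 1)).toReal / (16 * σ) ^ d * h ^ d
      = ∫ x in Metric.ball b (h / (16 * σ)), c / 2 := by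
        rw [setIntegral_const, Measure.real, hvol, div_pow, smul_eq_mul]
        ring
    _ ≤ ∫ x in Metric.ball b (h / (16 * σ)), f x * hat M.tri z x := by
        refine setIntegral_mono_on (by simp [measure_ball_lt_top]) (hint.mono_set hbΩ) measurableSet_ball
          fun x hx => ?_
        have := hb x hx
        have := hfc x (hbΩ hx)
        nlinarith
    _ ≤ M.load f z := by
        refine setIntegral_mono_set hint ?_ (LE.le.eventuallyLE hbΩ)
        refine (ae_restrict_iff' hΩo.measurableSet).2 (.of_forall fun x hx => ?_)
        exact mul_nonneg (hc.trans (hfc x hx)) (hat_nonneg _ _ _)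

end OlikerPrussner

namespace OlikerPrussner

/-! ### Subdifferentials of nodal functions -/

variable {d : ℕ} {Ω : Set (Pt d)} {h : ℝ}

namespace NodalMesh

variable (M : NodalMesh d Ω h)

/-- The measure `|∂v(z)|` of the subdifferential of a nodal function. -/
noncomputable def area (v : Pt d → ℝ) (z : Pt d) : ℝ := (volume (M.subdiff v z)).toReal

lemma area_nonneg (v : Pt d → ℝ) (z : Pt d) : 0 ≤ M.area v z := ENNReal.toReal_nonneg

variable {M} in
lemma mem_nodes_of_mem_interior {z : Pt d} (hz : z ∈ M.interior) : z ∈ M.nodes := Or.inl hz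

variable {M} in
lemma mem_nodes_of_mem_boundary {z : Pt d} (hz : z ∈ M.boundary) : z ∈ M.nodes := Or.inr hz

lemma isClosed_subdiff (v : Pt d → ℝ) (z : Pt d) : IsClosed (M.subdiff v z) := by
  have : M.subdiff v z = ⋂ y ∈ M.nodes, {p | v z + inner ℝ p (y - z) ≤ v y} := by
    ext p; simp [subdiff]
  rw [this]
  exact isClosed_biInter fun y _ => isClosed_le (by fun_prop) (by fun_prop)

lemma space_subset_convexHull_nodes : M.tri.space ⊆ convexHull ℝ M.nodes := by
  intro x hx
  obtain ⟨s, hs, hxs⟩ := Geometry.SimplicialComplex.mem_space_iff.1 hx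
  exact convexHull_mono (fun y hy => M.mem_nodes_of_mem_face hs hy) hxs

/-- The node z is interior to the convex hull of the nodes, so a supporting slope p is bounded by
testing it a fixed distance from z in the direction p. -/
lemma isCompact_subdiff (v : Pt d → ℝ) {z : Pt d} (hz : z ∈ M.interior) :
    IsCompact (M.subdiff v z) := by
  refine Metric.isCompact_of_isClosed_isBounded (M.isClosed_subdiff v z) ?_
  obtain ⟨r, hr, hball⟩ := Metric.mem_nhds_iff.1 (M.covers z hz)
  obtain ⟨B, hB⟩ := (M.finite_nodes.image fun y => v y - v z).bddAbove
  refine (Metric.isBounded_closedBall (x := (0 : Pt d)) (r := 2 * B / r)).subset fun p hp => ?_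
  rw [mem_closedBall_zero_iff]
  have hB0 : 0 ≤ B := by
    simpa using hB ⟨z, mem_nodes_of_mem_interior hz, rfl⟩
  rcases eq_or_ne p 0 with rfl | hp0
  · simp; positivity
  have hpn : 0 < ‖p‖ := norm_pos_iff.2 hp0
  have hsub : convexHull ℝ M.nodes ⊆ {y | inner ℝ p (y - z) ≤ B} := by
    refine convexHull_min (fun y hy => ?_) ?_
    · have h1 := hp y hy
      have h2 := hB ⟨y, hy, rfl⟩
      simp only [Set.mem_ofPred_eq] at *
      linarith
    · intro x hx y hy a b ha hb hab
      simp only [Set.mem_ofPred_eq] at *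
      have : a • x + b • y - z = a • (x - z) + b • (y - z) := by
        rw [show a • x + b • y - z = a • x + b • y - (a + b) • z by rw [hab, one_smul]]
        module
      rw [this, inner_add_right, inner_smul_right, inner_smul_right]
      calc a * inner ℝ p (x - z) + b * inner ℝ p (y - z) ≤ a * B + b * B := by gcongr
        _ = B := by rw [← add_mul, hab, one_mul]
  have hy : z + (r / (2 * ‖p‖)) • p ∈ Metric.ball z r := by
    rw [Metric.mem_ball, dist_eq_norm, add_sub_cancel_left, norm_smul, Real.norm_eq_abs,
      abs_of_nonneg (by positivity)]
    field_simp
    linarith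
  have := hsub (M.space_subset_convexHull_nodes (hball hy))
  simp only [Set.mem_ofPred_eq, add_sub_cancel_left, inner_smul_right,
    real_inner_self_eq_norm_sq] at this
  rw [le_div_iff₀ hr]
  field_simp at this
  linarith

open scoped Pointwise in
lemma subdiff_const_mul {c : ℝ} (hc : 0 < c) (v : Pt d → ℝ) (z : Pt d) :
    M.subdiff (fun x => c * v x) z = c • M.subdiff v z := by
  ext p
  rw [Set.mem_smul_set_iff_inv_smul_mem₀ hc.ne']
  simp only [subdiff, Set.mem_ofPred_eq]
  refine forall₂_congr fun y _ => ?_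
  rw [real_inner_smul_left]
  conv_rhs => rw [← mul_le_mul_iff_right₀ hc, mul_add, mul_inv_cancel_left₀ hc.ne']

lemma area_const_mul {c : ℝ} (hc : 0 < c) (v : Pt d → ℝ) (z : Pt d) :
    M.area (fun x => c * v x) z = c ^ d * M.area v z := by
  rw [area, subdiff_const_mul _ hc, Measure.addHaar_smul, ENNReal.toReal_mul,
    finrank_euclideanSpace, Fintype.card_fin, ENNReal.toReal_ofReal (abs_nonneg _),
    abs_of_pos (by positivity), area]

end NodalMesh

lemma volume_hyperplane {a : Pt d} (ha : a ≠ 0) (c : ℝ) :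
    volume {p : Pt d | inner ℝ p a = c} = 0 := by
  set S : AffineSubspace ℝ (Pt d) :=
    AffineSubspace.mk' ((c / ‖a‖ ^ 2) • a) (LinearMap.ker (innerSL ℝ a).toLinearMap)
  have haa : ‖a‖ ^ 2 ≠ 0 := by simpa using ha
  have hS : (S : Set (Pt d)) = {p | inner ℝ p a = c} := by
    ext p
    simp only [S, SetLike.mem_coe, AffineSubspace.mem_mk', LinearMap.mem_ker, vsub_eq_sub,
      ContinuousLinearMap.coe_coe, innerSL_apply_apply, inner_sub_right, inner_smul_right,
      real_inner_self_eq_norm_sq, Set.mem_ofPred_eq]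
    rw [div_mul_cancel₀ _ haa, sub_eq_zero, real_inner_comm]
  rw [← hS]
  refine Measure.addHaar_affineSubspace _ _ fun htop => ?_
  have h1 : ((c + 1) / ‖a‖ ^ 2) • a ∈ (S : Set (Pt d)) := by rw [htop]; trivial
  rw [hS] at h1
  simp only [Set.mem_ofPred_eq, real_inner_smul_left, real_inner_self_eq_norm_sq,
    div_mul_cancel₀ _ haa] at h1
  linarith

namespace NodalMesh

variable (M : NodalMesh d Ω h)

/-- A slope supporting at both nodes satisfies p · (y - z) = v(y) - v(z), which is a hyperplane of
slopes. -/
lemma aedisjoint_subdiff (v : Pt d → ℝ) {z y : Pt d} (hz : z ∈ M.nodes) (hy : y ∈ M.nodes)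
    (hzy : z ≠ y) : AEDisjoint volume (M.subdiff v z) (M.subdiff v y) := by
  refine measure_mono_null (fun p hp => ?_) (volume_hyperplane (sub_ne_zero.2 hzy.symm) (v y - v z))
  have h1 := hp.1 y hy
  have h2 := hp.2 z hz
  rw [← neg_sub y z, inner_neg_right] at h2
  simp only [Set.mem_ofPred_eq]
  linarith

lemma sum_area_eq (v : Pt d → ℝ) {D : Finset (Pt d)} (hD : D ⊆ M.interior) :
    ∑ z ∈ D, M.area v z = (volume (⋃ z ∈ D, M.subdiff v z)).toReal := by
  rw [measure_biUnion_finset₀, ENNReal.toReal_sum]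
  · rfl
  · exact fun z hz => (M.isCompact_subdiff v (hD hz)).measure_lt_top.ne
  · exact fun z hz y hy hzy => M.aedisjoint_subdiff v (mem_nodes_of_mem_interior (hD hz))
      (mem_nodes_of_mem_interior (hD hy)) hzy
  · exact fun z _ => (M.isClosed_subdiff v z).measurableSet.nullMeasurableSet

/-- Monotonicity of the subdifferential: pushing a nodal function down on a set of interior nodes
enlarges the set of slopes attained there. -/
lemma biUnion_subdiff_subset {v w : Pt d → ℝ} {D : Finset (Pt d)}
    (hle : ∀ z ∈ D, w z ≤ v z) (hge : ∀ z ∈ M.nodes, z ∉ D → v z ≤ w z) :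
    ⋃ z ∈ D, M.subdiff v z ⊆ ⋃ z ∈ D, M.subdiff w z := by
  intro p hp
  simp only [Set.mem_iUnion, exists_prop] at hp ⊢
  obtain ⟨z, hz, hpz⟩ := hp
  -- Translate the plane of slope p until it touches w from below on D. It stays below w off D,
  -- because there w ≥ v and at z the plane has only moved down.
  obtain ⟨k, hk, hmin⟩ := D.exists_min_image (fun y => w y - inner ℝ p y) ⟨z, hz⟩
  refine ⟨k, hk, fun y hy => ?_⟩
  have hzk := hmin z hz
  rw [inner_sub_right]
  by_cases hyD : y ∈ D
  · have := hmin y hyD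
    linarith
  · have h1 := hpz y hy
    have h2 := hge y hy hyD
    have h3 := hle z hz
    rw [inner_sub_right] at h1
    linarith

lemma sum_area_le_sum_area {v w : Pt d → ℝ} {D : Finset (Pt d)} (hD : D ⊆ M.interior)
    (hle : ∀ z ∈ D, w z ≤ v z) (hge : ∀ z ∈ M.nodes, z ∉ D → v z ≤ w z) :
    ∑ z ∈ D, M.area v z ≤ ∑ z ∈ D, M.area w z := by
  rw [M.sum_area_eq v hD, M.sum_area_eq w hD]
  refine ENNReal.toReal_mono ?_ (measure_mono (M.biUnion_subdiff_subset hle hge))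
  refine ((measure_biUnion_finset_le _ _).trans_lt (ENNReal.sum_lt_top.2 fun z hz => ?_)).ne
  exact (M.isCompact_subdiff w (hD hz)).measure_lt_top

/-- Comparison principle for nodal functions. -/
lemma le_of_area_lt {v w : Pt d → ℝ} (hb : ∀ z ∈ M.boundary, v z ≤ w z)
    (hlt : ∀ z ∈ M.interior, M.area w z < M.area v z) : ∀ z ∈ M.nodes, v z ≤ w z := by
  classical
  -- On the set where the claim fails, monotonicity bounds the total area of v by that of w, against
  -- the strict nodewise inequality.
  set D := M.interior.filter fun z => w z < v z with hD
  have hsum : ∑ z ∈ D, M.area v z ≤ ∑ z ∈ D, M.area w z := by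
    refine M.sum_area_le_sum_area (Finset.filter_subset _ _)
      (fun z hz => (Finset.mem_filter.1 hz).2.le) fun z hz hzD => ?_
    rcases hz with hz | hz
    · by_contra! hlt
      exact hzD (Finset.mem_filter.2 ⟨hz, hlt⟩)
    · exact hb z hz
  have hempty : D = ∅ := by
    by_contra hne
    refine absurd hsum (not_le.2 (Finset.sum_lt_sum_of_nonempty
      (Finset.nonempty_iff_ne_empty.2 hne) fun z hz => hlt z (Finset.mem_filter.1 hz).1))
  rintro z (hz | hz)
  · by_contra! hlt
    have : z ∈ D := Finset.mem_filter.2 ⟨hz, hlt⟩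
    simp [hempty] at this
  · exact hb z hz

open scoped Pointwise in
/-- Brunn–Minkowski bound for the subdifferential of `v₁ - (1 - ε) v₂`. -/
lemma area_sub_le {v₁ v₂ : Pt d → ℝ} {ε s : ℝ} (hε : 0 < ε) (hε1 : ε < 1) {z : Pt d}
    (hz : z ∈ M.interior) (hpos : 0 < M.area v₂ z)
    (hle : M.area v₁ z ≤ Real.exp s * M.area v₂ z) :
    M.area (fun x => v₁ x - (1 - ε) * v₂ x) z ≤ ε ^ d * Real.exp (s / ε) * M.area v₂ z := by
  set w : Pt d → ℝ := fun x => v₁ x - (1 - ε) * v₂ x with hw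
  set X := M.area (fun x => ε⁻¹ * w x) z with hX
  -- As v₁ = ε (w/ε) + (1 - ε) v₂, the set ε ∂(w/ε) + (1 - ε) ∂v₂ lies in ∂v₁. No convexity of w is
  -- needed: if ∂w is empty, X = 0.
  have hBM : X ^ ε * M.area v₂ z ^ (1 - ε) ≤ M.area v₁ z := by
    refine brunnMinkowski (M.isCompact_subdiff _ hz) (M.isCompact_subdiff _ hz)
      (M.isCompact_subdiff _ hz) hε hε1 fun p hp q hq y hy => ?_
    have h1 := mul_le_mul_of_nonneg_left (hp y hy) hε.le
    have h2 := mul_le_mul_of_nonneg_left (hq y hy) (sub_pos.2 hε1).le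
    simp only [mul_add, mul_inv_cancel_left₀ hε.ne', hw] at h1 h2
    rw [inner_add_left, real_inner_smul_left, real_inner_smul_left]
    linarith
  have hX0 : 0 ≤ X := M.area_nonneg _ _
  have h1 : X ^ ε ≤ (Real.exp (s / ε) * M.area v₂ z) ^ ε := by
    rw [Real.mul_rpow (Real.exp_pos _).le hpos.le, ← Real.exp_mul, div_mul_cancel₀ _ hε.ne']
    have e : M.area v₂ z = M.area v₂ z ^ ε * M.area v₂ z ^ (1 - ε) := by
      rw [← Real.rpow_add hpos]; simp
    have h2 := hBM.trans hle
    conv_rhs at h2 => rw [e, ← mul_assoc]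
    exact le_of_mul_le_mul_right h2 (by positivity)
  have h2 : X ≤ Real.exp (s / ε) * M.area v₂ z :=
    (Real.rpow_le_rpow_iff hX0 (by positivity) hε).1 h1
  rw [hX, M.area_const_mul (inv_pos.2 hε), inv_pow, inv_mul_le_iff₀ (by positivity)] at h2
  linarith

open scoped Classical in
/-- The interior nodes at which a nodal function has no supporting hyperplane. -/
noncomputable def nonContact (w : Pt d → ℝ) : Finset (Pt d) :=
  M.interior.filter fun z => ¬ (M.subdiff w z).Nonempty

lemma nonContact_subset (w : Pt d → ℝ) : M.nonContact w ⊆ M.interior := by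
  classical
  exact Finset.filter_subset _ _

variable {M} in
lemma nonempty_subdiff_of_notMem_nonContact {w : Pt d → ℝ} {z : Pt d} (hz : z ∈ M.interior)
    (hzw : z ∉ M.nonContact w) : (M.subdiff w z).Nonempty := by
  classical
  by_contra hne
  exact hzw (Finset.mem_filter.2 ⟨hz, hne⟩)

/-- The measure of the complement of the contact set of `v₁ - (1 - ε) v₂` is controlled by the
relative difference of the measures of `v₁` and `v₂`. -/
lemma sum_nonContact_le {v₁ v₂ : Pt d → ℝ} (hv₁ : ∀ z ∈ M.boundary, v₁ z = 0)
    (hv₂ : ∀ z ∈ M.boundary, v₂ z = 0) {ε η s : ℝ} (hη : 0 ≤ η) (hηε : η < ε) (hε1 : ε < 1)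
    (hs : 0 ≤ s) (hle : ∀ z ∈ M.interior, v₁ z ≤ (1 - η) * v₂ z)
    (hpos : ∀ z ∈ M.interior, 0 < M.area v₂ z)
    (harea : ∀ z ∈ M.interior, M.area v₁ z ≤ Real.exp s * M.area v₂ z) :
    ∑ z ∈ M.nonContact fun x => v₁ x - (1 - ε) * v₂ x, M.area v₂ z ≤
      (d * η + s) / ε * ∑ z ∈ M.interior, M.area v₂ z := by
  classical
  have hε : 0 < ε := hη.trans_lt hηε
  set w : Pt d → ℝ := fun x => v₁ x - (1 - ε) * v₂ x with hw
  set S := ∑ z ∈ M.interior, M.area v₂ z with hS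
  set N := M.nonContact w with hN
  have hS0 : 0 ≤ S := Finset.sum_nonneg fun z _ => M.area_nonneg _ _
  have hsplit : ∑ z ∈ N, M.area v₂ z + ∑ z ∈ M.interior \ N, M.area v₂ z = S := by
    rw [add_comm]
    exact Finset.sum_sdiff (Finset.filter_subset _ _)
  -- At interior nodes w ≤ (ε - η) v₂, with equality at the boundary nodes; lowering a function
  -- inside increases its total area.
  have h1 : (ε - η) ^ d * S ≤ ∑ z ∈ M.interior, M.area w z := by
    rw [hS, Finset.mul_sum]
    simp_rw [← M.area_const_mul (sub_pos.2 hηε)]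
    refine M.sum_area_le_sum_area subset_rfl (fun z hz => ?_) fun z hz hzi => ?_
    · have := hle z hz
      simp only [hw]
      linarith
    · rcases hz with hz | hz
      · exact absurd hz hzi
      · simp [hw, hv₁ z hz, hv₂ z hz]
  -- Nodes of N have empty subdifferential and drop out of the sum, which is why the upper bound
  -- sees only the contact set.
  have h2 : ∑ z ∈ M.interior, M.area w z ≤
      ε ^ d * Real.exp (s / ε) * ∑ z ∈ M.interior \ N, M.area v₂ z := by
    have hNi : N ⊆ M.interior := Finset.filter_subset _ _
    rw [← Finset.sum_sdiff hNi,
      Finset.sum_eq_zero (s := N) (fun z hz => ?_), add_zero, Finset.mul_sum]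
    · refine Finset.sum_le_sum fun z hz => ?_
      have hz := (Finset.mem_sdiff.1 hz).1
      exact M.area_sub_le hε hε1 hz (hpos z hz) (harea z hz)
    · have := (Finset.mem_filter.1 hz).2
      rw [Set.not_nonempty_iff_eq_empty] at this
      simp [area, this]
  set T := ∑ z ∈ M.interior \ N, M.area v₂ z
  have h3 : Real.exp (-(s / ε)) * (1 - η / ε) ^ d * S ≤ T := by
    have e : (ε - η) ^ d = ε ^ d * (1 - η / ε) ^ d := by
      rw [← mul_pow]; congr 1; field_simp
    have := h1.trans h2
    rw [e, mul_assoc, mul_assoc] at this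
    have := le_of_mul_le_mul_left this (by positivity)
    rw [Real.exp_neg, mul_assoc, inv_mul_le_iff₀ (Real.exp_pos _)]
    exact this
  have hq : η / ε ≤ 1 := by rw [div_le_one hε]; exact hηε.le
  have hq0 : 0 ≤ η / ε := by positivity
  have h4 : 1 - s / ε ≤ Real.exp (-(s / ε)) := by
    have := Real.add_one_le_exp (-(s / ε))
    linarith
  have h5 : 1 - d * (η / ε) ≤ (1 - η / ε) ^ d := by
    have := one_add_mul_le_pow (a := -(η / ε)) (by linarith) d
    rw [← sub_eq_add_neg] at this
    linarith
  have h6 : Real.exp (-(s / ε)) ≤ 1 := Real.exp_le_one_iff.2 (by simp; positivity)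
  have h7 : (1 - η / ε) ^ d ≤ 1 := pow_le_one₀ (by linarith) (by linarith)
  -- From (1 - x)(1 - y) ≥ 0 with both factors of the product at most 1, using 1 - x for the
  -- exponential and Bernoulli for the power.
  have h8 : 1 - (d * η + s) / ε ≤ Real.exp (-(s / ε)) * (1 - η / ε) ^ d := by
    have e : (d * η + s) / ε = d * (η / ε) + s / ε := by ring
    rw [e]
    nlinarith [mul_nonneg (sub_nonneg.2 h6) (sub_nonneg.2 h7)]
  have h9 := mul_le_mul_of_nonneg_right h8 hS0
  linarith

end NodalMesh

end OlikerPrussner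

namespace OlikerPrussner

/-! ### Convex functions of class `C^{1,1}` vanishing on the boundary -/

variable {d : ℕ} {Ω : Set (Pt d)} {u : Pt d → ℝ}

/-- A ray that starts in a bounded open set leaves its closure at a boundary point. -/
lemma exit_mem_frontier (hΩo : IsOpen Ω) (hΩb : Bornology.IsBounded Ω) {x w : Pt d} (hx : x ∈ Ω)
    (hw : w ≠ 0) : 0 < sSup {t : ℝ | 0 < t ∧ x + t • w ∈ closure Ω} ∧
      x + sSup {t : ℝ | 0 < t ∧ x + t • w ∈ closure Ω} • w ∈ frontier Ω := by
  set T := {t : ℝ | 0 < t ∧ x + t • w ∈ closure Ω} with hT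
  have hwn : 0 < ‖w‖ := norm_pos_iff.2 hw
  have hext : ∀ t : ℝ, x + t • w ∈ Ω → ∃ s > t, x + s • w ∈ Ω := by
    intro t ht
    have hc : Continuous fun s : ℝ => x + s • w := by fun_prop
    obtain ⟨r, hr, hball⟩ := Metric.isOpen_iff.1 (hΩo.preimage hc) t ht
    exact ⟨t + r / 2, by linarith, hball (by simp [abs_of_pos hr]; linarith)⟩
  have hbdd : BddAbove T := by
    obtain ⟨D, hD⟩ := Metric.isBounded_iff.1 hΩb.closure
    refine ⟨D / ‖w‖, fun t ht => ?_⟩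
    have := hD ht.2 (subset_closure hx)
    rw [dist_eq_norm, add_sub_cancel_left, norm_smul, Real.norm_eq_abs, abs_of_pos ht.1] at this
    rwa [le_div_iff₀ hwn]
  obtain ⟨s₀, hs₀, hs₀Ω⟩ := hext 0 (by simpa using hx)
  have hs₀T : s₀ ∈ T := ⟨hs₀, subset_closure hs₀Ω⟩
  have hpos : 0 < sSup T := lt_of_lt_of_le hs₀ (le_csSup hbdd hs₀T)
  refine ⟨hpos, ?_, ?_⟩
  · have hcl : IsClosed {t : ℝ | x + t • w ∈ closure Ω} :=
      isClosed_closure.preimage (by fun_prop)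
    exact hcl.closure_subset_iff.2 (fun t ht => ht.2) (csSup_mem_closure ⟨s₀, hs₀T⟩ hbdd)
  · rw [hΩo.interior_eq]
    intro hmem
    obtain ⟨s, hs, hsΩ⟩ := hext _ hmem
    exact absurd (le_csSup hbdd (show s ∈ T from ⟨hpos.trans hs, subset_closure hsΩ⟩))
      (not_le.2 hs)

lemma exists_exit (hΩo : IsOpen Ω) (hΩb : Bornology.IsBounded Ω) {x w : Pt d} (hx : x ∈ Ω)
    (hw : w ≠ 0) : ∃ t : ℝ, 0 < t ∧ x + t • w ∈ frontier Ω :=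
  ⟨_, exit_mem_frontier hΩo hΩb hx hw⟩

lemma nonpos_of_convexOn (hd : d ≠ 0) (hΩo : IsOpen Ω) (hΩb : Bornology.IsBounded Ω)
    (hu : ConvexOn ℝ (closure Ω) u) (hu0 : ∀ x ∈ frontier Ω, u x = 0) {x : Pt d}
    (hx : x ∈ closure Ω) : u x ≤ 0 := by
  by_cases hxf : x ∈ frontier Ω
  · exact (hu0 x hxf).le
  have hxΩ : x ∈ Ω := by
    by_contra h
    exact hxf ⟨hx, by rwa [hΩo.interior_eq]⟩
  have : Nonempty (Fin d) := ⟨⟨0, Nat.pos_of_ne_zero hd⟩⟩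
  obtain ⟨w, hw⟩ := exists_ne (0 : Pt d)
  obtain ⟨t, ht, htΩ⟩ := exists_exit hΩo hΩb hxΩ hw
  obtain ⟨s, hs, hsΩ⟩ := exists_exit hΩo hΩb hxΩ (neg_ne_zero.2 hw)
  have hst : 0 < s + t := by positivity
  have := hu.2 (frontier_subset_closure htΩ) (frontier_subset_closure hsΩ)
    (show 0 ≤ s / (s + t) by positivity) (show 0 ≤ t / (s + t) by positivity)
    (by rw [← add_div, div_self hst.ne'])
  rw [hu0 _ htΩ, hu0 _ hsΩ] at this
  have e : (s / (s + t)) • (x + t • w) + (t / (s + t)) • (x + s • -w) = x := by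
    have : (s / (s + t)) • (x + t • w) + (t / (s + t)) • (x + s • -w) =
        ((s + t) / (s + t)) • x := by module
    rw [this, div_self hst.ne', one_smul]
  rw [e] at this
  simpa using this

/-- A convex solution of the Monge–Ampère equation with positive right-hand side is somewhere
negative. -/
lemma IsMongeAmpereSolution.exists_neg (hd : d ≠ 0) (hΩo : IsOpen Ω)
    (hΩb : Bornology.IsBounded Ω) {f : Pt d → ℝ} {c : ℝ} (hc : 0 < c)
    (hf : ∀ x ∈ Ω, c ≤ f x) (hu : IsMongeAmpereSolution Ω f u) (hne : Ω.Nonempty) :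
    ∃ x ∈ Ω, u x < 0 := by
  by_contra! hcon
  have hzero : ∀ x ∈ Ω, u x = 0 := fun x hx => le_antisymm
    (nonpos_of_convexOn hd hΩo hΩb hu.convexOn hu.boundary (subset_closure hx)) (hcon x hx)
  -- If u vanishes on Ω, the only supporting slope is 0, so the Monge–Ampère measure of Ω is zero,
  -- against the lower bound c|Ω| > 0.
  have hsub : ⋃ x ∈ Ω, subdiff Ω u x ⊆ {0} := by
    intro p hp
    simp only [Set.mem_iUnion, exists_prop] at hp
    obtain ⟨x, hx, hpx⟩ := hp
    obtain ⟨r, hr, hball⟩ := Metric.isOpen_iff.1 hΩo x hx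
    by_contra hp0
    have hpn : 0 < ‖p‖ := norm_pos_iff.2 hp0
    have hy : x + (r / (2 * ‖p‖)) • p ∈ Ω := hball (by
      rw [Metric.mem_ball, dist_eq_norm, add_sub_cancel_left, norm_smul, Real.norm_eq_abs,
        abs_of_nonneg (by positivity)]
      field_simp
      linarith)
    have := hpx _ hy
    rw [hzero _ hx, hzero _ hy, add_sub_cancel_left, inner_smul_right,
      real_inner_self_eq_norm_sq] at this
    have : 0 < r / (2 * ‖p‖) * ‖p‖ ^ 2 := by positivity
    linarith
  have h1 := hu.measure_eq Ω hΩo.measurableSet subset_rfl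
  have : Nonempty (Fin d) := ⟨⟨0, Nat.pos_of_ne_zero hd⟩⟩
  rw [measure_mono_null hsub (by simp)] at h1
  have h2 : ∫⁻ x in Ω, ENNReal.ofReal c ≤ ∫⁻ x in Ω, ENNReal.ofReal (f x) :=
    setLIntegral_mono' hΩo.measurableSet fun x hx => ENNReal.ofReal_le_ofReal (hf x hx)
  rw [← h1, setLIntegral_const, nonpos_iff_eq_zero, mul_eq_zero, ENNReal.ofReal_eq_zero] at h2
  rcases h2 with h2 | h2
  · linarith
  · exact (hΩo.measure_pos volume hne).ne' h2

/-- At every point of `s` the function `u` lies between an affine function with slope of norm at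
most `L` and the same affine function plus `K` times the squared distance. -/
def HasTangents (s : Set (Pt d)) (u : Pt d → ℝ) (K L : ℝ) : Prop :=
  ∀ x ∈ s, ∃ p : Pt d, ‖p‖ ≤ L ∧ ∀ y ∈ s, u x + inner ℝ p (y - x) ≤ u y ∧
    u y ≤ u x + inner ℝ p (y - x) + K * ‖y - x‖ ^ 2

lemma abs_sub_fderiv_le (hΩo : IsOpen Ω) (hΩc : Convex ℝ Ω) (hu : DifferentiableOn ℝ u Ω) {K : ℝ≥0}
    (hK : LipschitzOnWith K (fderiv ℝ u) Ω) {x y : Pt d} (hx : x ∈ Ω) (hy : y ∈ Ω) :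
    |u y - u x - fderiv ℝ u x (y - x)| ≤ K * ‖y - x‖ ^ 2 := by
  have hseg : segment ℝ x y ⊆ Ω := hΩc.segment_subset hx hy
  have := (convex_segment x y).norm_image_sub_le_of_norm_hasFDerivWithin_le' (𝕜 := ℝ) (f := u)
    (f' := fderiv ℝ u) (φ := fderiv ℝ u x) (C := K * ‖y - x‖)
    (fun z hz => ((hu z (hseg hz)).differentiableAt
      (hΩo.mem_nhds (hseg hz))).hasFDerivAt.hasFDerivWithinAt)
    (fun z hz => by
      refine (hK.norm_sub_le (hseg hz) hx).trans ?_
      gcongr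
      obtain ⟨a, b, ha, hb, hab, rfl⟩ := hz
      have : a • x + b • y - x = b • (y - x) := by
        rw [show a • x + b • y - x = a • x + b • y - (a + b) • x by rw [hab, one_smul]]
        module
      rw [this, norm_smul, Real.norm_eq_abs, abs_of_nonneg hb]
      nlinarith [norm_nonneg (y - x)])
    (left_mem_segment ℝ x y) (right_mem_segment ℝ x y)
  rw [Real.norm_eq_abs] at this
  linarith

lemma hasTangents_of_isC11 (hΩo : IsOpen Ω) (hΩb : Bornology.IsBounded Ω) (hΩc : Convex ℝ Ω)
    (hu : ConvexOn ℝ (closure Ω) u) (hreg : IsC11 Ω u) :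
    ∃ K L : ℝ, 0 < K ∧ 0 < L ∧ HasTangents Ω u K L := by
  obtain ⟨-, hdiff, K, hK⟩ := hreg
  rcases Ω.eq_empty_or_nonempty with rfl | ⟨x₀, hx₀⟩
  · exact ⟨1, 1, one_pos, one_pos, fun x hx => hx.elim⟩
  obtain ⟨D, hD⟩ := Metric.isBounded_iff.1 hΩb
  have hD0 : 0 ≤ D := by simpa using hD hx₀ hx₀
  refine ⟨K + 1, ‖fderiv ℝ u x₀‖ + K * D + 1, by positivity, by positivity, fun x hx => ?_⟩
  refine ⟨(InnerProductSpace.toDual ℝ (Pt d)).symm (fderiv ℝ u x), ?_, fun y hy => ?_⟩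
  · rw [LinearIsometryEquiv.norm_map]
    have h1 := hK.norm_sub_le hx hx₀
    have h2 := norm_le_norm_add_norm_sub' (fderiv ℝ u x) (fderiv ℝ u x₀)
    have h3 := mul_le_mul_of_nonneg_left (hD hx hx₀) K.2
    rw [dist_eq_norm] at h3
    have h3 : (K : ℝ) * ‖x - x₀‖ ≤ K * D := h3
    linarith
  · rw [InnerProductSpace.toDual_symm_apply]
    constructor
    · have key : ∀ t : ℝ, 0 < t → t ≤ 1 →
          fderiv ℝ u x (y - x) ≤ u y - u x + t * (K * ‖y - x‖ ^ 2) := by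
        intro t ht ht1
        have hmem : x + t • (y - x) ∈ Ω := hΩc.add_smul_sub_mem hx hy ⟨ht.le, ht1⟩
        have h1 := (abs_le.1 (abs_sub_fderiv_le hΩo hΩc hdiff hK hx hmem)).1
        have h2 := hu.2 (subset_closure hx) (subset_closure hy) (sub_nonneg.2 ht1) ht.le (by ring)
        have e : (1 - t) • x + t • y = x + t • (y - x) := by module
        rw [e] at h2
        simp only [smul_eq_mul] at h2
        rw [add_sub_cancel_left, map_smul, norm_smul, Real.norm_eq_abs, abs_of_pos ht, mul_pow,
          smul_eq_mul] at h1
        refine le_of_mul_le_mul_left ?_ ht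
        nlinarith
      by_contra! hlt
      set G := (K : ℝ) * ‖y - x‖ ^ 2
      have hG : 0 ≤ G := by positivity
      set g := fderiv ℝ u x (y - x) - (u y - u x)
      have hg : 0 < g := by simp only [g]; linarith
      -- A violation g > 0 of the tangent inequality is refuted by any t ≤ 1 with tG < g; this is
      -- the limit t → 0 made explicit.
      have h1 := key (g / (2 * (g + G))) (by positivity)
        (by rw [div_le_one (by positivity)]; linarith)
      have h2 : g / (2 * (g + G)) * G < g := by
        rw [div_mul_eq_mul_div, div_lt_iff₀ (by positivity)]
        nlinarith [mul_nonneg hg.le hG]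
      simp only [g] at h2
      linarith
    · have h1 := (abs_le.1 (abs_sub_fderiv_le hΩo hΩc hdiff hK hx hy)).2
      nlinarith [sq_nonneg ‖y - x‖]

/-- Slopes at interior points are bounded by L, so they subconverge along a sequence tending to a
boundary point, and the inequalities pass to the limit. The boundary slopes are what controls the
shape of ∂Ω. -/
lemma hasTangents_closure {K L : ℝ} (hu : ContinuousOn u (closure Ω))
    (hT : HasTangents Ω u K L) : HasTangents (closure Ω) u K L := by
  intro x hx
  obtain ⟨xs, hxs, hlim⟩ := mem_closure_iff_seq_limit.1 hx
  choose p hpL hp using fun n => hT (xs n) (hxs n)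
  obtain ⟨q, -, φ, hφ, hq⟩ := tendsto_subseq_of_bounded
    (Metric.isBounded_closedBall (x := (0 : Pt d)) (r := L))
    (fun n => mem_closedBall_zero_iff.2 (hpL n))
  have hlim' : Filter.Tendsto (xs ∘ φ) Filter.atTop (nhds x) := hlim.comp hφ.tendsto_atTop
  have hulim : Filter.Tendsto (fun n => u (xs (φ n))) Filter.atTop (nhds (u x)) :=
    (hu x hx).tendsto.comp (tendsto_nhdsWithin_iff.2 ⟨hlim', .of_forall fun n =>
      subset_closure (hxs _)⟩)
  refine ⟨q, le_of_tendsto hq.norm (.of_forall fun n => hpL _), ?_⟩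
  have hΩ : ∀ y ∈ Ω, u x + inner ℝ q (y - x) ≤ u y ∧
      u y ≤ u x + inner ℝ q (y - x) + K * ‖y - x‖ ^ 2 := by
    intro y hy
    have hi : Filter.Tendsto (fun n => u (xs (φ n)) + inner ℝ (p (φ n)) (y - xs (φ n)))
        Filter.atTop (nhds (u x + inner ℝ q (y - x))) :=
      hulim.add (hq.inner (hlim'.const_sub y))
    refine ⟨le_of_tendsto hi (.of_forall fun n => (hp _ y hy).1), ?_⟩
    exact ge_of_tendsto (hi.add (((hlim'.const_sub y).norm.pow 2).const_mul K))
      (.of_forall fun n => (hp _ y hy).2)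
  intro y hy
  have hcont : ContinuousWithinAt u Ω y := (hu y hy).mono subset_closure
  exact ⟨ContinuousWithinAt.closure_le hy (Continuous.continuousWithinAt (by fun_prop)) hcont
    fun z hz => (hΩ z hz).1,
    ContinuousWithinAt.closure_le hy hcont (Continuous.continuousWithinAt (by fun_prop))
      fun z hz => (hΩ z hz).2⟩

lemma HasTangents.sub_le {s : Set (Pt d)} {K L : ℝ} (hT : HasTangents s u K L) {x y : Pt d}
    (hx : x ∈ s) (hy : y ∈ s) : u x - u y ≤ L * ‖y - x‖ := by
  obtain ⟨p, hp, h⟩ := hT x hx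
  have h1 := (h y hy).1
  have h2 := abs_le.1 (abs_real_inner_le_norm p (y - x))
  have h3 := mul_le_mul_of_nonneg_right hp (norm_nonneg (y - x))
  linarith

/-- The slope of `u` at a boundary point bounds the radius of an interior touching ball, hence
every boundary point near a point `y` at which a linear form `q` is maximal lies within second
order of the supporting hyperplane. -/
lemma HasTangents.inner_le {K L D : ℝ} (hΩo : IsOpen Ω) (hΩc : Convex ℝ Ω)
    (hD : 0 < D) (hΩD : ∀ x ∈ closure Ω, ∀ y ∈ closure Ω, ‖x - y‖ ≤ D)
    (hK : 0 < K) (hT : HasTangents (closure Ω) u K L)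
    (hu0 : ∀ x ∈ frontier Ω, u x = 0) {x₀ : Pt d} (hx₀ : x₀ ∈ Ω) (hneg : u x₀ < 0)
    {y q : Pt d} (hy : y ∈ frontier Ω) (hq : ∀ x ∈ closure Ω, (inner ℝ q x : ℝ) ≤ inner ℝ q y)
    {z : Pt d} (hz : z ∈ frontier Ω) :
    inner ℝ q (y - z) ≤ K * D / (-u x₀) * ‖q‖ * ‖y - z‖ ^ 2 := by
  set m := -u x₀ with hm
  have hm0 : 0 < m := by linarith
  obtain ⟨p, -, hp⟩ := hT y (frontier_subset_closure hy)
  rw [hu0 y hy] at hp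
  rcases eq_or_ne q 0 with rfl | hq0
  · simp
  have hqn : 0 < ‖q‖ := norm_pos_iff.2 hq0
  have hpx₀ : m ≤ inner ℝ p (y - x₀) := by
    have := (hp x₀ (subset_closure hx₀)).1
    rw [← neg_sub, inner_neg_right] at this
    linarith
  have hpD : m ≤ ‖p‖ * D := hpx₀.trans ((real_inner_le_norm _ _).trans
    (mul_le_mul_of_nonneg_left (hΩD _ (frontier_subset_closure hy) _ (subset_closure hx₀))
      (norm_nonneg _)))
  have hpn : 0 < ‖p‖ := by
    by_contra! h
    nlinarith
  -- B is the set where the quadratic upper bound for u at y is negative. It contains no boundary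
  -- point, since u = 0 there; being connected and meeting Ω, it lies in Ω.
  set B := Metric.ball (y - (1 / (2 * K)) • p) (‖p‖ / (2 * K)) with hB
  have hmemB : ∀ x, x ∈ B ↔ inner ℝ p (x - y) + K * ‖x - y‖ ^ 2 < 0 := by
    intro x
    rw [hB, Metric.mem_ball, dist_eq_norm, ← sq_lt_sq₀ (norm_nonneg _) (by positivity),
      show x - (y - (1 / (2 * K)) • p) = (x - y) + (1 / (2 * K)) • p by module,
      norm_add_sq_real, norm_smul, inner_smul_right, Real.norm_eq_abs,
      abs_of_pos (by positivity : 0 < 1 / (2 * K)), real_inner_comm]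
    constructor
    · intro h
      have := mul_lt_mul_of_pos_left h hK
      field_simp at this
      nlinarith
    · intro h
      refine lt_of_mul_lt_mul_left ?_ hK.le
      field_simp
      nlinarith
  have hBΩ : B ⊆ Ω := by
    refine (convex_ball _ _).isPreconnected.subset_of_closure_inter_subset hΩo ?_ ?_
    · set s := m / (m + K * D ^ 2)
      have hs : 0 < s := by positivity
      have hs1 : s ≤ 1 := by
        rw [div_le_one (by positivity)]
        have : 0 ≤ K * D ^ 2 := by positivity
        linarith
      refine ⟨y + s • (x₀ - y), ?_, ?_⟩
      · rw [hmemB, add_sub_cancel_left, inner_smul_right, norm_smul, Real.norm_eq_abs,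
          abs_of_pos hs, ← neg_sub, inner_neg_right, norm_neg]
        have h1 := hΩD _ (frontier_subset_closure hy) _ (subset_closure hx₀)
        have h2 : ‖y - x₀‖ ^ 2 ≤ D ^ 2 := by gcongr
        have h3 : s * (K * D ^ 2) < m := by
          simp only [s]
          rw [div_mul_eq_mul_div, div_lt_iff₀ (by positivity)]
          nlinarith
        have h4 : s * (K * ‖y - x₀‖ ^ 2) ≤ s * (K * D ^ 2) := by gcongr
        nlinarith
      · have := hΩc.combo_closure_interior_mem_interior (frontier_subset_closure hy)
          (hΩo.interior_eq.symm ▸ hx₀) (sub_nonneg.2 hs1) hs (by ring)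
        rw [hΩo.interior_eq] at this
        convert this using 1
        module
    · rintro x ⟨hx, hxB⟩
      by_contra hxΩ
      have hxf : x ∈ frontier Ω := ⟨hx, by rwa [hΩo.interior_eq]⟩
      have h1 := (hp x hx).1
      have h2 := (hp x hx).2
      have h3 := (hmemB x).1 hxB
      rw [hu0 x hxf] at h2
      linarith
  -- Testing the maximality of q at y on the extreme point of the closed ball B in direction q gives
  -- equality in Cauchy–Schwarz, so p and q are parallel.
  have hpq : ‖q‖ * ‖p‖ ≤ inner ℝ q p := by
    have hmem : y - (1 / (2 * K)) • p + (‖p‖ / (2 * K) / ‖q‖) • q ∈ closure Ω := by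
      refine closure_mono hBΩ ?_
      rw [hB, closure_ball _ (by positivity), Metric.mem_closedBall, dist_eq_norm,
        add_sub_cancel_left, norm_smul, Real.norm_eq_abs, abs_of_nonneg (by positivity),
        div_mul_cancel₀ _ hqn.ne']
    have := hq _ hmem
    rw [inner_add_right, inner_sub_right, inner_smul_right, inner_smul_right,
      real_inner_self_eq_norm_sq] at this
    field_simp at this
    nlinarith
  have heq : ‖p‖ • q = ‖q‖ • p :=
    inner_eq_norm_mul_iff_real.1 (le_antisymm (real_inner_le_norm _ _) hpq)
  have hpz : inner ℝ p (y - z) ≤ K * ‖y - z‖ ^ 2 := by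
    have := (hp z (frontier_subset_closure hz)).2
    rw [hu0 z hz, ← neg_sub y z, inner_neg_right, norm_neg] at this
    linarith
  have h1 : ‖p‖ * inner ℝ q (y - z) = ‖q‖ * inner ℝ p (y - z) := by
    rw [← real_inner_smul_left, heq, real_inner_smul_left]
  have h2 : ‖p‖ * inner ℝ q (y - z) ≤ ‖q‖ * (K * ‖y - z‖ ^ 2) := by
    rw [h1]; gcongr
  refine le_of_mul_le_mul_left (h2.trans ?_) hpn
  have e : ‖p‖ * (K * D / m * ‖q‖ * ‖y - z‖ ^ 2) =
      (‖q‖ * (K * ‖y - z‖ ^ 2)) * (‖p‖ * D / m) := by ring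
  rw [e]
  refine le_mul_of_one_le_right (by positivity) ?_
  rwa [one_le_div hm0]

/-- An affine function that is nonpositive at the boundary nodes and bounded below by `τ u z` at an
interior node `z` has slope `O(τ)` and is at most `O(τ h²)` on all of `Ω`. -/
lemma NodalMesh.slope_bound {h : ℝ} (M : NodalMesh d Ω h) (hh : 0 < h) (hd : d ≠ 0)
    (hΩo : IsOpen Ω) (hΩb : Bornology.IsBounded Ω) {K L A : ℝ} (hL : 0 ≤ L) (hA0 : 0 ≤ A)
    (hT : HasTangents (closure Ω) u K L) (hu0 : ∀ x ∈ frontier Ω, u x = 0)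
    (hA : ∀ y ∈ frontier Ω, ∀ q : Pt d, (∀ x ∈ closure Ω, (inner ℝ q x : ℝ) ≤ inner ℝ q y) →
      ∀ z ∈ frontier Ω, inner ℝ q (y - z) ≤ A * ‖q‖ * ‖y - z‖ ^ 2) (hAh : A * h ≤ 1 / 4)
    {z : Pt d} (hz : z ∈ M.interior) {q : Pt d} {a τ : ℝ} (hτ : 0 ≤ τ) (ha : τ * u z ≤ a)
    (hb : ∀ y ∈ M.boundary, a + inner ℝ q (y - z) ≤ 0) :
    ‖q‖ ≤ 2 * τ * L ∧ ∀ x ∈ closure Ω, a + inner ℝ q (x - z) ≤ 2 * τ * L * A * h ^ 2 := by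
  have hzΩ := M.interior_mem z hz
  rcases eq_or_ne q 0 with rfl | hq0
  · have : Nonempty (Fin d) := ⟨⟨0, Nat.pos_of_ne_zero hd⟩⟩
    obtain ⟨w, hw⟩ := exists_ne (0 : Pt d)
    obtain ⟨t, -, ht⟩ := exists_exit hΩo hΩb hzΩ hw
    obtain ⟨y, hy, -⟩ := M.boundary_dense _ ht
    have := hb y hy
    simp only [inner_zero_left, add_zero, norm_zero] at this ⊢
    exact ⟨by positivity, fun x _ => this.trans (by positivity)⟩
  have hqn : 0 < ‖q‖ := norm_pos_iff.2 hq0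
  obtain ⟨y, hy, hmax⟩ := hΩb.isCompact_closure.exists_isMaxOn ⟨z, subset_closure hzΩ⟩
    (f := fun x => (inner ℝ q x : ℝ)) (by fun_prop)
  have hmax' : ∀ x ∈ closure Ω, (inner ℝ q x : ℝ) ≤ inner ℝ q y := fun x hx => hmax hx
  have hyf : y ∈ frontier Ω := by
    refine ⟨hy, fun hyi => ?_⟩
    rw [hΩo.interior_eq] at hyi
    obtain ⟨t, ht, htΩ⟩ := exists_exit hΩo hΩb hyi hq0
    have := hmax' _ (frontier_subset_closure htΩ)
    rw [inner_add_right, inner_smul_right, real_inner_self_eq_norm_sq] at this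
    have : 0 < t * ‖q‖ ^ 2 := by positivity
    linarith
  obtain ⟨b, hbB, hyb⟩ := M.boundary_dense y hyf
  rw [dist_eq_norm] at hyb
  have h1 : a + inner ℝ q (y - z) ≤ A * ‖q‖ * h ^ 2 := by
    have e : y - z = (b - z) + (y - b) := by abel
    rw [e, inner_add_right]
    have i1 := hb b hbB
    have i2 := hA y hyf q hmax' b (M.boundary_mem b hbB)
    have i3 : A * ‖q‖ * ‖y - b‖ ^ 2 ≤ A * ‖q‖ * h ^ 2 := by gcongr
    linarith
  obtain ⟨t, ht, htΩ⟩ := exists_exit hΩo hΩb hzΩ (w := ‖q‖⁻¹ • q)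
    (smul_ne_zero (inv_ne_zero hqn.ne') hq0)
  have hnorm : ‖t • ‖q‖⁻¹ • q‖ = t := by
    rw [norm_smul, norm_smul, norm_inv, norm_norm, inv_mul_cancel₀ hqn.ne', mul_one,
      Real.norm_eq_abs, abs_of_pos ht]
  have hth : h / 2 ≤ t := by
    have := M.dist_boundary z hz _ htΩ
    rwa [dist_self_add_right, hnorm] at this
  have h2 : t * ‖q‖ ≤ inner ℝ q (y - z) := by
    have := hmax' _ (frontier_subset_closure htΩ)
    rw [inner_add_right, inner_smul_right, inner_smul_right, real_inner_self_eq_norm_sq] at this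
    rw [inner_sub_right]
    have e : t * (‖q‖⁻¹ * ‖q‖ ^ 2) = t * ‖q‖ := by field_simp
    linarith
  have h3 : -u z ≤ L * t := by
    have := hT.sub_le (frontier_subset_closure htΩ) (subset_closure hzΩ)
    rw [hu0 _ htΩ, ← norm_neg, neg_sub, add_sub_cancel_left, hnorm] at this
    linarith
  -- The inequalities combine to t‖q‖ ≤ A‖q‖h² + τLt. Since Ah ≤ 1/4 and h ≤ 2t, the first term is
  -- at most t‖q‖/2 and is absorbed.
  have hq : ‖q‖ ≤ 2 * τ * L := by
    have h4 : A * ‖q‖ * h ^ 2 ≤ ‖q‖ * t / 2 := by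
      have i1 : A * h * (‖q‖ * h) ≤ 1 / 4 * (‖q‖ * h) := by gcongr
      have i2 : ‖q‖ * h ≤ ‖q‖ * (2 * t) := by gcongr; linarith
      nlinarith
    have h5 : τ * -u z ≤ τ * (L * t) := by gcongr
    refine le_of_mul_le_mul_right ?_ ht
    nlinarith
  refine ⟨hq, fun x hx => ?_⟩
  have h4 := hmax' x hx
  have h5 : A * ‖q‖ * h ^ 2 ≤ A * (2 * τ * L) * h ^ 2 := by gcongr
  rw [inner_sub_right] at *
  linarith

end OlikerPrussner

namespace OlikerPrussner

/-! ### Second order differences -/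

variable {d : ℕ} {Ω : Set (Pt d)} {h : ℝ}

namespace NodalMesh

variable (M : NodalMesh d Ω h)

lemma interp_eq {u : Pt d → ℝ} {y : Pt d} (hy : y ∈ M.nodes) : M.interp u y = u y :=
  Set.indicator_of_mem hy u

lemma value_of_mem {v : Pt d → ℝ} {y : Pt d} (hy : y ∈ M.nodes) : M.value v y = v y :=
  if_pos hy

lemma value_of_notMem {v : Pt d → ℝ} {y : Pt d} (hy : y ∉ M.nodes) : M.value v y = 0 :=
  if_neg hy

lemma value_sub_mul (v₁ v₂ : Pt d → ℝ) (c : ℝ) (y : Pt d) :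
    M.value (fun x => v₁ x - c * v₂ x) y = M.value v₁ y - c * M.value v₂ y := by
  by_cases hy : y ∈ M.nodes
  · simp [M.value_of_mem hy]
  · simp [M.value_of_notMem hy]

lemma value_interp {u : Pt d → ℝ} (hu0 : ∀ x ∈ frontier Ω, u x = 0) {y : Pt d}
    (hy : y ∈ M.nodes ∨ y ∈ frontier Ω) : M.value (M.interp u) y = u y := by
  by_cases hyn : y ∈ M.nodes
  · rw [M.value_of_mem hyn, M.interp_eq hyn]
  · rw [M.value_of_notMem hyn, hu0 y (hy.resolve_left hyn)]

lemma secondDiff_sub_mul (e : Fin d → ℤ) (v₁ v₂ : Pt d → ℝ) (c : ℝ) (x : Pt d) :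
    M.secondDiff e (fun x => v₁ x - c * v₂ x) x =
      M.secondDiff e v₁ x - c * M.secondDiff e v₂ x := by
  simp only [secondDiff, value_sub_mul]
  ring

lemma step_spec (hh : 0 < h) (hΩo : IsOpen Ω) (hΩb : Bornology.IsBounded Ω) {z w : Pt d}
    (hz : z ∈ M.interior) (hw : w ≠ 0) :
    0 < M.step z w ∧ (z + M.step z w • w ∈ M.nodes ∨ z + M.step z w • w ∈ frontier Ω) ∧
      h / 2 ≤ M.step z w * ‖w‖ := by
  by_cases hn : z + w ∈ M.nodes
  · have : M.step z w = 1 := if_pos hn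
    rw [this, one_smul, one_mul]
    refine ⟨one_pos, Or.inl hn, ?_⟩
    have := M.half_le_dist hh hz hn (by simpa using hw)
    rwa [dist_self_add_right] at this
  · have : M.step z w = sSup {t : ℝ | 0 < t ∧ z + t • w ∈ closure Ω} := if_neg hn
    obtain ⟨h1, h2⟩ := exit_mem_frontier hΩo hΩb (M.interior_mem z hz) hw
    rw [← this] at h1 h2
    refine ⟨h1, Or.inr h2, ?_⟩
    have := M.dist_boundary z hz _ h2
    rwa [dist_self_add_right, norm_smul, Real.norm_eq_abs, abs_of_pos h1] at this

/-- The geometric data entering `δ_e` at an interior node. -/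
lemma secondDiff_spec (hh : 0 < h) (hΩo : IsOpen Ω) (hΩb : Bornology.IsBounded Ω) {z : Pt d}
    (hz : z ∈ M.interior) {e : Fin d → ℤ} (he : e ≠ 0) :
    ∃ (r s : ℝ) (w : Pt d), 0 < r ∧ 0 < s ∧ 1 / 2 ≤ r * ‖intVec e‖ ∧ 1 / 2 ≤ s * ‖intVec e‖ ∧
      ‖w‖ = ‖intVec e‖ * h ∧ (z + r • w ∈ M.nodes ∨ z + r • w ∈ frontier Ω) ∧
      (z - s • w ∈ M.nodes ∨ z - s • w ∈ frontier Ω) ∧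
      ∀ v, M.secondDiff e v z =
        (s * (M.value v (z + r • w) - M.value v z) + r * (M.value v (z - s • w) - M.value v z)) /
          (r * s * (r + s) * ‖intVec e‖ ^ 2 * h ^ 2 / 2) := by
  have he1 := one_le_norm_intVec he
  have hw : h • intVec e ≠ 0 := smul_ne_zero hh.ne' (norm_pos_iff.1 (by linarith))
  obtain ⟨h1, h2, h3⟩ := M.step_spec hh hΩo hΩb hz hw
  obtain ⟨h4, h5, h6⟩ := M.step_spec hh hΩo hΩb hz (neg_ne_zero.2 hw)
  have hn : ‖h • intVec e‖ = ‖intVec e‖ * h := by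
    rw [norm_smul, Real.norm_eq_abs, abs_of_pos hh, mul_comm]
  rw [norm_neg] at h6
  rw [hn, ← mul_assoc] at h3 h6
  rw [smul_neg, ← sub_eq_add_neg] at h5
  refine ⟨_, _, _, h1, h4, ?_, ?_, hn, h2, h5, fun v => ?_⟩
  · exact le_of_mul_le_mul_right (by linarith) hh
  · exact le_of_mul_le_mul_right (by linarith) hh
  · simp only [secondDiff]
    congr 1
    ring

/-- A supporting hyperplane up to an error `B` bounds `δ_e` from below. -/
lemma neg_le_secondDiff (hh : 0 < h) (hΩo : IsOpen Ω) (hΩb : Bornology.IsBounded Ω) {z : Pt d}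
    (hz : z ∈ M.interior) {e : Fin d → ℤ} (he : e ≠ 0) {v : Pt d → ℝ} {q : Pt d} {B : ℝ}
    (hB : 0 ≤ B) (hv : ∀ y, y ∈ M.nodes ∨ y ∈ frontier Ω →
      M.value v z + inner ℝ q (y - z) - B ≤ M.value v y) :
    -(8 * B / h ^ 2) ≤ M.secondDiff e v z := by
  obtain ⟨r, s, w, hr, hs, hre, hse, -, hyr, hys, hspec⟩ := M.secondDiff_spec hh hΩo hΩb hz he
  have h1 := hv _ hyr
  have h2 := hv _ hys
  have e2 : z - s • w - z = -(s • w) := by abel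
  rw [add_sub_cancel_left, inner_smul_right] at h1
  rw [e2, inner_neg_right, inner_smul_right] at h2
  have he1 := one_le_norm_intVec he
  set n := ‖intVec e‖
  -- Each arm has length at least h/2. The numerator loses at most (r + s)B, so the quotient loses
  -- 2B/(r s n² h²) ≤ 8B/h², independently of e.
  have hrs : 1 / 4 ≤ r * s * n ^ 2 := by
    have := mul_le_mul hre hse (by norm_num) (by positivity)
    linarith
  have hnum : -((r + s) * B) ≤ s * (M.value v (z + r • w) - M.value v z) +
      r * (M.value v (z - s • w) - M.value v z) := by
    have i1 := mul_le_mul_of_nonneg_left h1 hs.le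
    have i2 := mul_le_mul_of_nonneg_left h2 hr.le
    linarith
  rw [hspec v, le_div_iff₀ (by positivity)]
  refine le_trans ?_ hnum
  have e3 : -(8 * B / h ^ 2) * (r * s * (r + s) * n ^ 2 * h ^ 2 / 2) =
      -((r + s) * B * (4 * (r * s * n ^ 2))) := by
    field_simp
    ring
  rw [e3, neg_le_neg_iff]
  exact le_mul_of_one_le_right (by positivity) (by linarith)

/-- The second order differences of a function with quadratic upper bounds are bounded above. -/
lemma secondDiff_interp_le (hh : 0 < h) (hΩo : IsOpen Ω) (hΩb : Bornology.IsBounded Ω) {z : Pt d}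
    (hz : z ∈ M.interior) {e : Fin d → ℤ} (he : e ≠ 0) {u : Pt d → ℝ}
    (hu0 : ∀ x ∈ frontier Ω, u x = 0) {K L : ℝ} (hT : HasTangents (closure Ω) u K L) :
    M.secondDiff e (M.interp u) z ≤ 2 * K := by
  obtain ⟨r, s, w, hr, hs, -, -, hw, hyr, hys, hspec⟩ := M.secondDiff_spec hh hΩo hΩb hz he
  obtain ⟨p, -, hp⟩ := hT z (subset_closure (M.interior_mem z hz))
  have hcl : ∀ y, y ∈ M.nodes ∨ y ∈ frontier Ω → y ∈ closure Ω := fun y hy =>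
    hy.elim (fun hy => M.nodes_subset_closure hy) fun hy => frontier_subset_closure hy
  have h1 := (hp _ (hcl _ hyr)).2
  have h2 := (hp _ (hcl _ hys)).2
  have e2 : z - s • w - z = -(s • w) := by abel
  rw [add_sub_cancel_left, inner_smul_right, norm_smul, Real.norm_eq_abs, abs_of_pos hr, hw] at h1
  rw [e2, inner_neg_right, inner_smul_right, norm_neg, norm_smul, Real.norm_eq_abs, abs_of_pos hs,
    hw] at h2
  have he1 := one_le_norm_intVec he
  rw [hspec, M.value_interp hu0 hyr, M.value_interp hu0 hys,
    M.value_interp hu0 (Or.inl (mem_nodes_of_mem_interior hz)), div_le_iff₀ (by positivity)]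
  have i1 := mul_le_mul_of_nonneg_left h1 hs.le
  have i2 := mul_le_mul_of_nonneg_left h2 hr.le
  nlinarith

lemma abs_secondDiff_le (hh : 0 < h) (hΩo : IsOpen Ω) (hΩb : Bornology.IsBounded Ω) {z : Pt d}
    (hz : z ∈ M.interior) {e : Fin d → ℤ} (he : e ≠ 0) {v : Pt d → ℝ} {B : ℝ}
    (hv : ∀ y ∈ M.nodes, |v y| ≤ B) : |M.secondDiff e v z| ≤ 16 * B / h ^ 2 := by
  have hB : 0 ≤ B := (abs_nonneg _).trans (hv z (mem_nodes_of_mem_interior hz))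
  have key : ∀ v : Pt d → ℝ, (∀ y ∈ M.nodes, |v y| ≤ B) →
      -(16 * B / h ^ 2) ≤ M.secondDiff e v z := by
    intro v hv
    have hval : ∀ y, |M.value v y| ≤ B := by
      intro y
      by_cases hy : y ∈ M.nodes
      · rw [M.value_of_mem hy]; exact hv y hy
      · rw [M.value_of_notMem hy]; simpa using hB
    have := M.neg_le_secondDiff hh hΩo hΩb hz he (v := v) (q := 0) (B := 2 * B) (by positivity)
      fun y _ => by
        have h1 := abs_le.1 (hval y)
        have h2 := abs_le.1 (hval z)
        rw [inner_zero_left]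
        linarith
    rwa [← mul_assoc, show (8 : ℝ) * 2 = 16 by norm_num] at this
  have h1 := key v hv
  have h2 := key (fun x => 0 - 1 * v x) fun y hy => by simpa using hv y hy
  have h3 := M.secondDiff_sub_mul e (fun _ => 0) v 1 z
  have h4 : M.secondDiff e (fun _ => 0) z = 0 := by
    simp [secondDiff, value]
  rw [h3, h4] at h2
  exact abs_le.2 ⟨h1, by linarith⟩

/-- At a contact node the second order differences are almost nonnegative. -/
lemma neg_le_secondDiff_of_nonempty (hh : 0 < h) (hd : d ≠ 0) (hΩo : IsOpen Ω)
    (hΩb : Bornology.IsBounded Ω) {u : Pt d → ℝ} {K L A : ℝ} (hL : 0 ≤ L) (hA0 : 0 ≤ A)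
    (hT : HasTangents (closure Ω) u K L) (hu0 : ∀ x ∈ frontier Ω, u x = 0)
    (hA : ∀ y ∈ frontier Ω, ∀ q : Pt d, (∀ x ∈ closure Ω, (inner ℝ q x : ℝ) ≤ inner ℝ q y) →
      ∀ z ∈ frontier Ω, inner ℝ q (y - z) ≤ A * ‖q‖ * ‖y - z‖ ^ 2) (hAh : A * h ≤ 1 / 4)
    {z : Pt d} (hz : z ∈ M.interior) {e : Fin d → ℤ} (he : e ≠ 0) {w : Pt d → ℝ}
    (hw : ∀ y ∈ M.boundary, w y = 0) {τ : ℝ} (hτ : 0 ≤ τ) (hwz : τ * u z ≤ w z)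
    (hne : (M.subdiff w z).Nonempty) :
    -(16 * τ * L * A) ≤ M.secondDiff e w z := by
  obtain ⟨q, hq⟩ := hne
  -- The supporting plane lies below w at nodes only; at other boundary points used by δ_e the value
  -- is 0, and this bounds how far the plane exceeds it.
  have hB := (M.slope_bound hh hd hΩo hΩb hL hA0 hT hu0 hA hAh hz hτ hwz fun y hy => by
    rw [← hw y hy]; exact hq y (mem_nodes_of_mem_boundary hy)).2
  have hB0 : 0 ≤ 2 * τ * L * A * h ^ 2 := by positivity
  have := M.neg_le_secondDiff hh hΩo hΩb hz he (v := w) (q := q) hB0 fun y hy => by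
    rw [M.value_of_mem (mem_nodes_of_mem_interior hz)]
    by_cases hyn : y ∈ M.nodes
    · rw [M.value_of_mem hyn]
      have := hq y hyn
      linarith
    · rw [M.value_of_notMem hyn]
      have := hB y (frontier_subset_closure (hy.resolve_left hyn))
      linarith
  have e : 8 * (2 * τ * L * A * h ^ 2) / h ^ 2 = 16 * τ * L * A := by
    field_simp
    ring
  rwa [e] at this

end NodalMesh

/-! ### From weak-type bounds to sums of powers -/

/-- Either a ≤ C 2^(-N), or a lies in one of the first N dyadic shells C 2^(-k-1) < a ≤ C 2^(-k),
whose term dominates a^p. -/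
lemma rpow_le_dyadic {a C p : ℝ} (ha : 0 ≤ a) (haC : a ≤ C) (hp : 0 ≤ p) (N : ℕ) :
    a ^ p ≤ (C * (1 / 2) ^ N) ^ p +
      ∑ k ∈ Finset.range N, if C * (1 / 2) ^ (k + 1) < a then (C * (1 / 2) ^ k) ^ p else 0 := by
  have hC : 0 ≤ C := ha.trans haC
  have hnn : ∀ N : ℕ, 0 ≤ ∑ k ∈ Finset.range N,
      if C * (1 / 2) ^ (k + 1) < a then (C * (1 / 2) ^ k) ^ p else 0 := fun N =>
    Finset.sum_nonneg fun k _ => by split_ifs <;> positivity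
  induction N with
  | zero => simpa using Real.rpow_le_rpow ha haC hp
  | succ N ih =>
    by_cases hlt : C * (1 / 2) ^ (N + 1) < a
    · rw [Finset.sum_range_succ, if_pos hlt]
      have : 0 ≤ (C * (1 / 2) ^ (N + 1)) ^ p := by positivity
      linarith
    · have := Real.rpow_le_rpow ha (not_lt.1 hlt) hp
      linarith [hnn (N + 1)]

/-- Dyadic layer cake estimate. -/
lemma sum_mul_rpow_le {ι : Type*} (s : Finset ι) {f a : ι → ℝ} {F C B p : ℝ}
    (hf : ∀ i ∈ s, 0 ≤ f i) (hF : ∑ i ∈ s, f i ≤ F) (ha : ∀ i ∈ s, 0 ≤ a i)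
    (haC : ∀ i ∈ s, a i ≤ C) (hC : 0 < C) (hp : 0 ≤ p)
    (hweak : ∀ t, 0 < t → ∑ i ∈ s with t < a i, f i ≤ B / t) (N : ℕ) :
    ∑ i ∈ s, f i * a i ^ p ≤ F * (C * (1 / 2) ^ N) ^ p +
      ∑ k ∈ Finset.range N, (C * (1 / 2) ^ k) ^ p * (B / (C * (1 / 2) ^ (k + 1))) := by
  calc ∑ i ∈ s, f i * a i ^ p
      ≤ ∑ i ∈ s, f i * ((C * (1 / 2) ^ N) ^ p + ∑ k ∈ Finset.range N,
          if C * (1 / 2) ^ (k + 1) < a i then (C * (1 / 2) ^ k) ^ p else 0) :=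
        Finset.sum_le_sum fun i hi => mul_le_mul_of_nonneg_left
          (rpow_le_dyadic (ha i hi) (haC i hi) hp N) (hf i hi)
    _ = (∑ i ∈ s, f i) * (C * (1 / 2) ^ N) ^ p + ∑ k ∈ Finset.range N,
          (C * (1 / 2) ^ k) ^ p * ∑ i ∈ s with C * (1 / 2) ^ (k + 1) < a i, f i := by
        simp_rw [mul_add, Finset.sum_add_distrib, Finset.mul_sum, Finset.sum_mul]
        rw [Finset.sum_comm]
        congr 1
        refine Finset.sum_congr rfl fun k _ => ?_
        rw [Finset.sum_filter]
        refine Finset.sum_congr rfl fun i _ => ?_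
        split_ifs <;> ring
    _ ≤ _ := by
        gcongr with k hk
        exact hweak _ (by positivity)

end OlikerPrussner

namespace OlikerPrussner

/-! ### Comparison of the interpolant with the discrete solution -/

variable {d : ℕ} {Ω : Set (Pt d)} {h : ℝ}

namespace NodalMesh

variable (M : NodalMesh d Ω h)

/-- Comparison with (1 - η) v₂, whose area carries the factor (1 - η)^d ≤ 1 - η. -/
lemma le_one_sub_mul_of_area_lt (hd : d ≠ 0) {v₁ v₂ : Pt d → ℝ} {η : ℝ} (hη : 0 ≤ η) (hη1 : η < 1)
    (hv₁ : ∀ z ∈ M.boundary, v₁ z = 0) (hv₂ : ∀ z ∈ M.boundary, v₂ z = 0)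
    (hlt : ∀ z ∈ M.interior, (1 - η) * M.area v₂ z < M.area v₁ z) :
    ∀ z ∈ M.nodes, v₁ z ≤ (1 - η) * v₂ z := by
  refine M.le_of_area_lt (w := fun x => (1 - η) * v₂ x)
    (fun z hz => by simp [hv₁ z hz, hv₂ z hz]) fun z hz => ?_
  rw [M.area_const_mul (sub_pos.2 hη1)]
  refine lt_of_le_of_lt (mul_le_mul_of_nonneg_right ?_ (M.area_nonneg _ _)) (hlt z hz)
  exact pow_le_of_le_one (by linarith) (by linarith) hd

/-- Two-sided comparison of a nodal function `U` with nearly the right measure and a solution `v`. -/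
structure Close (f U v : Pt d → ℝ) (η : ℝ) : Prop where
  load_pos : ∀ z ∈ M.interior, 0 < M.load f z
  area_eq : ∀ z ∈ M.interior, M.area v z = M.load f z
  area_pos : ∀ z ∈ M.interior, 0 < M.area U z
  area_le : ∀ z ∈ M.interior, M.area v z ≤ Real.exp (2 * η) * M.area U z
  area_ge : ∀ z ∈ M.interior, M.area U z ≤ Real.exp (2 * η) * M.area v z
  boundary_left : ∀ z ∈ M.boundary, U z = 0
  boundary_right : ∀ z ∈ M.boundary, v z = 0
  le_left : ∀ z ∈ M.nodes, U z ≤ (1 - η) * v z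
  le_right : ∀ z ∈ M.nodes, v z ≤ (1 - η) * U z

/-- The lower bound on the loads turns the consistency error into a relative error δ = (|C₀|/c₁) h².
The extra h² in η supplies the strict inequality that comparison needs. -/
lemma close_of_consistency (hd : d ≠ 0) {f u v : Pt d → ℝ} (hu0 : ∀ x ∈ frontier Ω, u x = 0)
    {c₁ C₀ : ℝ} (hh : 0 < h) (hc₁ : 0 < c₁) (hload : ∀ z ∈ M.interior, c₁ * h ^ d ≤ M.load f z)
    (hcons : M.ConsistencyLE f u (C₀ * h ^ (2 + d))) (hv : M.IsSolution f v)
    (hη : (|C₀| / c₁ + 1) * h ^ 2 ≤ 1 / 2) :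
    M.Close f (M.interp u) v ((|C₀| / c₁ + 1) * h ^ 2) := by
  set κ := |C₀| / c₁ with hκ
  have hκ0 : 0 ≤ κ := by positivity
  have hh2 : 0 < h ^ 2 := by positivity
  set δ := κ * h ^ 2 with hδ
  have hδ0 : 0 ≤ δ := by positivity
  set η := (κ + 1) * h ^ 2 with hηdef
  have hδη : δ < η := by rw [hδ, hηdef]; nlinarith
  have hpos : ∀ z ∈ M.interior, 0 < M.load f z := fun z hz =>
    lt_of_lt_of_le (by positivity) (hload z hz)
  have hav : ∀ z ∈ M.interior, M.area v z = M.load f z := fun z hz => by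
    rw [area, hv.measure_eq z hz, ENNReal.toReal_ofReal (hpos z hz).le]
  have hcl : ∀ z ∈ M.interior, |M.area (M.interp u) z - M.load f z| ≤ δ * M.load f z := by
    intro z hz
    refine (hcons z hz).2.trans ?_
    have h1 : C₀ * h ^ (2 + d) ≤ |C₀| * h ^ (2 + d) := by
      gcongr; exact le_abs_self _
    have h2 : |C₀| * h ^ (2 + d) = δ * (c₁ * h ^ d) := by
      rw [hδ, hκ, pow_add]; field_simp
    rw [h2] at h1
    exact h1.trans (mul_le_mul_of_nonneg_left (hload z hz) hδ0)
  have hU0 : ∀ z ∈ M.boundary, M.interp u z = 0 := fun z hz => by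
    rw [M.interp_eq (mem_nodes_of_mem_boundary hz), hu0 z (M.boundary_mem z hz)]
  have hge : ∀ z ∈ M.interior, (1 - δ) * M.load f z ≤ M.area (M.interp u) z := fun z hz => by
    have := (abs_le.1 (hcl z hz)).1
    linarith
  have hle : ∀ z ∈ M.interior, M.area (M.interp u) z ≤ (1 + δ) * M.load f z := fun z hz => by
    have := (abs_le.1 (hcl z hz)).2
    linarith
  have hexp : 1 + 2 * η ≤ Real.exp (2 * η) := by
    have := Real.add_one_le_exp (2 * η)
    linarith
  refine ⟨hpos, hav, fun z hz => ?_, fun z hz => ?_, fun z hz => ?_, hU0, hv.boundary, ?_, ?_⟩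
  · have := hpos z hz
    have := hge z hz
    nlinarith
  · rw [hav z hz]
    have h1 : M.load f z ≤ (1 + 2 * η) * ((1 - δ) * M.load f z) := by
      have : 1 ≤ (1 + 2 * η) * (1 - δ) := by nlinarith
      have := mul_le_mul_of_nonneg_right this (hpos z hz).le
      linarith
    refine h1.trans ?_
    have h2 := hge z hz
    have h3 : 0 ≤ (1 - δ) * M.load f z := mul_nonneg (by linarith) (hpos z hz).le
    gcongr
  · rw [hav z hz]
    refine (hle z hz).trans (mul_le_mul_of_nonneg_right ?_ (hpos z hz).le)
    linarith
  · refine M.le_one_sub_mul_of_area_lt hd (by linarith) (by linarith) hU0 hv.boundary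
      fun z hz => ?_
    rw [hav z hz]
    refine lt_of_lt_of_le ?_ (hge z hz)
    exact mul_lt_mul_of_pos_right (by linarith) (hpos z hz)
  · refine M.le_one_sub_mul_of_area_lt hd (by linarith) (by linarith) hv.boundary hU0
      fun z hz => ?_
    rw [hav z hz]
    have h1 := mul_le_mul_of_nonneg_left (hle z hz) (show 0 ≤ 1 - η by linarith)
    refine h1.trans_lt ?_
    have h2 : (1 - η) * (1 + δ) < 1 := by nlinarith
    have := mul_lt_mul_of_pos_right h2 (hpos z hz)
    linarith

variable {M}

lemma Close.sum_nonContact_left_le {f U v : Pt d → ℝ} {η ε : ℝ} (hc : M.Close f U v η)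
    (hη : 0 ≤ η) (hηε : η < ε) (hε1 : ε < 1) :
    ∑ z ∈ M.nonContact fun x => U x - (1 - ε) * v x, M.load f z ≤
      (d + 2) * η / ε * ∑ z ∈ M.interior, M.load f z := by
  have := M.sum_nonContact_le hc.boundary_left hc.boundary_right hη hηε hε1
    (by positivity : 0 ≤ 2 * η) (fun z hz => hc.le_left z (mem_nodes_of_mem_interior hz))
    (fun z hz => by rw [hc.area_eq z hz]; exact hc.load_pos z hz) hc.area_ge
  rw [Finset.sum_congr rfl hc.area_eq,
    Finset.sum_congr rfl fun z hz => hc.area_eq z (M.nonContact_subset _ hz)] at this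
  rwa [add_mul]

/-- Here the natural weight is the area of U; replacing it by the load on both sides costs e^(2η) ≤
3 twice, hence 9. -/
lemma Close.sum_nonContact_right_le {f U v : Pt d → ℝ} {η ε : ℝ} (hc : M.Close f U v η)
    (hη : 0 ≤ η) (hη1 : η ≤ 1 / 2) (hηε : η < ε) (hε1 : ε < 1) :
    ∑ z ∈ M.nonContact fun x => v x - (1 - ε) * U x, M.load f z ≤
      9 * ((d + 2) * η / ε * ∑ z ∈ M.interior, M.load f z) := by
  have key := M.sum_nonContact_le hc.boundary_right hc.boundary_left hη hηε hε1
    (by positivity : 0 ≤ 2 * η) (fun z hz => hc.le_right z (mem_nodes_of_mem_interior hz))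
    hc.area_pos hc.area_le
  have hexp : Real.exp (2 * η) ≤ 3 :=
    (Real.exp_le_exp.2 (by linarith : 2 * η ≤ 1)).trans (by
      have := Real.exp_one_lt_d9
      linarith)
  have h1 : ∀ z ∈ M.interior, M.load f z ≤ 3 * M.area U z := fun z hz => by
    rw [← hc.area_eq z hz]
    exact (hc.area_le z hz).trans (mul_le_mul_of_nonneg_right hexp (M.area_nonneg _ _))
  have h2 : ∀ z ∈ M.interior, M.area U z ≤ 3 * M.load f z := fun z hz => by
    rw [← hc.area_eq z hz]
    exact (hc.area_ge z hz).trans (mul_le_mul_of_nonneg_right hexp (M.area_nonneg _ _))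
  have h3 : ∑ z ∈ M.interior, M.area U z ≤ 3 * ∑ z ∈ M.interior, M.load f z := by
    rw [Finset.mul_sum]; exact Finset.sum_le_sum h2
  have hε : 0 < ε := hη.trans_lt hηε
  calc ∑ z ∈ M.nonContact fun x => v x - (1 - ε) * U x, M.load f z
      ≤ 3 * ∑ z ∈ M.nonContact fun x => v x - (1 - ε) * U x, M.area U z := by
        rw [Finset.mul_sum]
        exact Finset.sum_le_sum fun z hz => h1 z (M.nonContact_subset _ hz)
    _ ≤ 3 * ((d * η + 2 * η) / ε * (3 * ∑ z ∈ M.interior, M.load f z)) := by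
        refine mul_le_mul_of_nonneg_left (key.trans ?_) (by norm_num)
        exact mul_le_mul_of_nonneg_left h3 (by positivity)
    _ = _ := by ring

/-- Outside the level sets of non-contact nodes, the second order error is small. -/
lemma Close.abs_secondDiff_le (hh : 0 < h) (hd : d ≠ 0) (hΩo : IsOpen Ω)
    (hΩb : Bornology.IsBounded Ω) {u : Pt d → ℝ} {K L A : ℝ} (hL : 0 ≤ L)
    (hA0 : 0 ≤ A) (hT : HasTangents (closure Ω) u K L) (hu0 : ∀ x ∈ frontier Ω, u x = 0)
    (hneg : ∀ x ∈ closure Ω, u x ≤ 0)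
    (hA : ∀ y ∈ frontier Ω, ∀ q : Pt d, (∀ x ∈ closure Ω, (inner ℝ q x : ℝ) ≤ inner ℝ q y) →
      ∀ z ∈ frontier Ω, inner ℝ q (y - z) ≤ A * ‖q‖ * ‖y - z‖ ^ 2) (hAh : A * h ≤ 1 / 4)
    {f v : Pt d → ℝ} {η ε C₁ : ℝ} (hη : 0 ≤ η) (hη1 : η ≤ 1 / 2)
    (hc : M.Close f (M.interp u) v η) (hηε : η < ε) (hε1 : ε < 1) {z : Pt d} (hz : z ∈ M.interior)
    {e : Fin d → ℤ} (he : e ≠ 0) (hC₁ : |M.secondDiff e (M.interp u - v) z| ≤ C₁)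
    (hl : z ∉ M.nonContact fun x => M.interp u x - (1 - ε) * v x)
    (hr : z ∉ M.nonContact fun x => v x - (1 - ε) * M.interp u x) :
    |M.secondDiff e (M.interp u - v) z| ≤ (2 * K + C₁ + 48 * L * A) * ε := by
  have hε : 0 < ε := hη.trans_lt hηε
  have hzn := mem_nodes_of_mem_interior hz
  have hl' : (M.subdiff (fun x => M.interp u x - (1 - ε) * v x) z).Nonempty :=
    nonempty_subdiff_of_notMem_nonContact hz hl
  have hr' : (M.subdiff (fun x => v x - (1 - ε) * M.interp u x) z).Nonempty :=
    nonempty_subdiff_of_notMem_nonContact hz hr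
  have hU : M.interp u z = u z := M.interp_eq hzn
  have huz : u z ≤ 0 := hneg z (subset_closure (M.interior_mem z hz))
  have hle1 := hc.le_left z hzn
  have hle2 := hc.le_right z hzn
  rw [hU] at hle1 hle2
  have h1 := M.neg_le_secondDiff_of_nonempty hh hd hΩo hΩb hL hA0 hT hu0 hA hAh hz he
    (w := fun x => M.interp u x - (1 - ε) * v x)
    (fun y hy => by simp [hc.boundary_left y hy, hc.boundary_right y hy])
    -- With u ≤ 0, the two-sided comparison gives w ≥ (ε + η - εη) u here and w ≥ (ε + 2η) u in the
    -- second case; both are at least 3εu.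
    (τ := 3 * ε) (by positivity) (by
      simp only [hU]
      have h1 := mul_le_mul_of_nonneg_left hle2 (sub_pos.2 hε1).le
      nlinarith [mul_nonneg (mul_nonneg hη hε.le) (neg_nonneg.2 huz),
        mul_nonneg (sub_nonneg.2 hηε.le) (neg_nonneg.2 huz)]) hl'
  have h2 := M.neg_le_secondDiff_of_nonempty hh hd hΩo hΩb hL hA0 hT hu0 hA hAh hz he
    (w := fun x => v x - (1 - ε) * M.interp u x)
    (fun y hy => by simp [hc.boundary_left y hy, hc.boundary_right y hy])
    (τ := 3 * ε) (by positivity) (by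
      simp only [hU]
      have h1 : (1 + 2 * η) * u z ≤ v z := by
        refine le_of_mul_le_mul_left ?_ (show 0 < 1 - η by linarith)
        refine le_trans ?_ hle1
        nlinarith [mul_nonneg (mul_nonneg hη (sub_nonneg.2 hη1)) (neg_nonneg.2 huz)]
      nlinarith [mul_nonneg (sub_nonneg.2 hηε.le) (neg_nonneg.2 huz)]) hr'
  rw [M.secondDiff_sub_mul] at h1 h2
  have h3 : M.secondDiff e (M.interp u - v) z =
      M.secondDiff e (M.interp u) z - M.secondDiff e v z := by
    have : M.interp u - v = fun x => M.interp u x - 1 * v x := by ext x; simp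
    rw [this, M.secondDiff_sub_mul, one_mul]
  have h4 := M.secondDiff_interp_le hh hΩo hΩb hz he hu0 hT
  have hC₁' := abs_le.1 hC₁
  have hC₁0 : 0 ≤ C₁ := (abs_nonneg _).trans hC₁
  rw [h3] at hC₁' ⊢
  have i1 := mul_le_mul_of_nonneg_left h4 hε.le
  have i2 : ε * M.secondDiff e v z ≤ ε * (2 * K + C₁) :=
    mul_le_mul_of_nonneg_left (by linarith) hε.le
  have i3 : 0 ≤ ε * C₁ := by positivity
  rw [abs_le]
  constructor <;> nlinarith

/-- The total mass of the right-hand side is bounded. -/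
lemma Close.sum_load_le (hh : 0 < h) (hd : d ≠ 0) (hΩo : IsOpen Ω)
    (hΩb : Bornology.IsBounded Ω) {u : Pt d → ℝ} {K L A : ℝ} (hL : 0 ≤ L)
    (hA0 : 0 ≤ A) (hT : HasTangents (closure Ω) u K L) (hu0 : ∀ x ∈ frontier Ω, u x = 0)
    (hneg : ∀ x ∈ closure Ω, u x ≤ 0)
    (hA : ∀ y ∈ frontier Ω, ∀ q : Pt d, (∀ x ∈ closure Ω, (inner ℝ q x : ℝ) ≤ inner ℝ q y) →
      ∀ z ∈ frontier Ω, inner ℝ q (y - z) ≤ A * ‖q‖ * ‖y - z‖ ^ 2) (hAh : A * h ≤ 1 / 4)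
    {f v : Pt d → ℝ} {η : ℝ} (hη1 : η ≤ 1 / 2) (hc : M.Close f (M.interp u) v η) :
    ∑ z ∈ M.interior, M.load f z ≤
      (volume (Metric.closedBall (0 : Pt d) (2 * 2 * L))).toReal := by
  rw [← Finset.sum_congr rfl fun z hz => hc.area_eq z hz, M.sum_area_eq v subset_rfl]
  refine ENNReal.toReal_mono measure_closedBall_lt_top.ne (measure_mono ?_)
  refine Set.iUnion₂_subset fun z hz q hq => mem_closedBall_zero_iff.2 ?_
  have hzn := mem_nodes_of_mem_interior hz
  -- Since η ≤ 1/2, v ≥ u/(1 - η) ≥ 2u; all slopes of v thus lie in one ball, which bounds the total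
  -- area.
  refine (M.slope_bound hh hd hΩo hΩb hL hA0 hT hu0 hA hAh hz (q := q) (a := v z) (τ := 2)
    (by norm_num) ?_ fun y hy => ?_).1
  · have h1 := hc.le_left z hzn
    have h2 := hneg z (subset_closure (M.interior_mem z hz))
    rw [M.interp_eq hzn] at h1
    refine le_of_mul_le_mul_left ?_ (show 0 < 1 - η by linarith)
    nlinarith
  · rw [← hc.boundary_right y hy]
    exact hq y (mem_nodes_of_mem_boundary hy)

/-- The weak-type estimate for the second order error. -/
lemma Close.sum_level_le (hh : 0 < h) (hd : d ≠ 0) (hΩo : IsOpen Ω)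
    (hΩb : Bornology.IsBounded Ω) {u : Pt d → ℝ} {K L A : ℝ} (hK : 0 < K) (hL : 0 ≤ L)
    (hA0 : 0 ≤ A) (hT : HasTangents (closure Ω) u K L) (hu0 : ∀ x ∈ frontier Ω, u x = 0)
    (hneg : ∀ x ∈ closure Ω, u x ≤ 0)
    (hA : ∀ y ∈ frontier Ω, ∀ q : Pt d, (∀ x ∈ closure Ω, (inner ℝ q x : ℝ) ≤ inner ℝ q y) →
      ∀ z ∈ frontier Ω, inner ℝ q (y - z) ≤ A * ‖q‖ * ‖y - z‖ ^ 2) (hAh : A * h ≤ 1 / 4)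
    {f v : Pt d → ℝ} {η C₁ F : ℝ} (hη : 0 ≤ η) (hη1 : η ≤ 1 / 2)
    (hc : M.Close f (M.interp u) v η) {e : Fin d → ℤ} (he : e ≠ 0)
    (hC₁ : ∀ z ∈ M.interior, |M.secondDiff e (M.interp u - v) z| ≤ C₁) (hC₁0 : 0 ≤ C₁)
    (hF : ∑ z ∈ M.interior, M.load f z ≤ F) {t : ℝ} (ht : 0 < t) :
    ∑ z ∈ M.interior with t < |M.secondDiff e (M.interp u - v) z|, M.load f z ≤
      10 * (d + 2) * F * (2 * K + C₁ + 48 * L * A) * η / t := by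
  classical
  set C₂ := 2 * K + C₁ + 48 * L * A with hC₂
  have hC₂0 : 0 < C₂ := by positivity
  set S := ∑ z ∈ M.interior, M.load f z
  have hS0 : 0 ≤ S := Finset.sum_nonneg fun z hz => (hc.load_pos z hz).le
  have hF0 : 0 ≤ F := hS0.trans hF
  set P := M.interior.filter fun z => t < |M.secondDiff e (M.interp u - v) z| with hP
  have hsub : P ⊆ M.interior := Finset.filter_subset _ _
  -- Chosen so that the error bound C₂ε at common contact nodes equals t. For ε ≥ 1 the level set is
  -- empty by the uniform bound; for ε ≤ η the total mass suffices.
  set ε := t / C₂ with hε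
  have hε0 : 0 < ε := by positivity
  have hrhs : 10 * (d + 2) * F * C₂ * η / t = 10 * ((d + 2) * η / ε * F) := by
    rw [hε]; field_simp
  rw [hrhs]
  rcases le_or_gt 1 ε with hε1 | hε1
  · have hempty : P = ∅ := by
      refine Finset.filter_eq_empty_iff.2 fun z hz => not_lt.2 ((hC₁ z hz).trans ?_)
      rw [hε, le_div_iff₀ hC₂0] at hε1
      have : 0 ≤ 48 * L * A := by positivity
      linarith
    rw [hempty, Finset.sum_empty]
    positivity
  rcases le_or_gt ε η with hεη | hεη
  · calc ∑ z ∈ P, M.load f z ≤ S :=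
          Finset.sum_le_sum_of_subset_of_nonneg hsub fun z hz _ => (hc.load_pos z hz).le
      _ ≤ 1 * F := by linarith
      _ ≤ (10 * ((d + 2) * η / ε)) * F := by
          refine mul_le_mul_of_nonneg_right ?_ hF0
          have h1 : 1 ≤ η / ε := by rwa [one_le_div hε0]
          have h2 : (10 * ((d + 2) * η / ε) : ℝ) = (10 * (d + 2)) * (η / ε) := by ring
          have h3 : (0 : ℝ) ≤ d := Nat.cast_nonneg d
          rw [h2]
          nlinarith
      _ = _ := by ring
  · set N₁ := M.nonContact fun x => M.interp u x - (1 - ε) * v x with hN₁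
    set N₂ := M.nonContact fun x => v x - (1 - ε) * M.interp u x with hN₂
    have hPN : P ⊆ N₁ ∪ N₂ := by
      intro z hz
      obtain ⟨hzi, hzt⟩ := Finset.mem_filter.1 hz
      by_contra hzN
      rw [Finset.mem_union, not_or] at hzN
      have := hc.abs_secondDiff_le hh hd hΩo hΩb hL hA0 hT hu0 hneg hA hAh hη hη1 hεη hε1
        hzi he (hC₁ z hzi) hzN.1 hzN.2
      rw [← hC₂, hε, mul_div_cancel₀ _ hC₂0.ne'] at this
      linarith
    have hNi : ∀ z ∈ N₁ ∪ N₂, 0 ≤ M.load f z := fun z hz => (hc.load_pos z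
      ((Finset.union_subset (M.nonContact_subset _) (M.nonContact_subset _)) hz)).le
    have h1 := hc.sum_nonContact_left_le hη hεη hε1
    have h2 := hc.sum_nonContact_right_le hη hη1 hεη hε1
    have h3 : (d + 2) * η / ε * S ≤ (d + 2) * η / ε * F := by gcongr
    calc ∑ z ∈ P, M.load f z ≤ ∑ z ∈ N₁ ∪ N₂, M.load f z :=
          Finset.sum_le_sum_of_subset_of_nonneg hPN fun z hz _ => hNi z hz
      _ ≤ ∑ z ∈ N₁ ∪ N₂, M.load f z + ∑ z ∈ N₁ ∩ N₂, M.load f z :=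
          le_add_of_nonneg_right (Finset.sum_nonneg fun z hz =>
            hNi z (Finset.inter_subset_union hz))
      _ = ∑ z ∈ N₁, M.load f z + ∑ z ∈ N₂, M.load f z := Finset.sum_union_inter
      _ ≤ _ := by linarith

/-- The nodal error is of order `η`. -/
lemma Close.abs_sub_le {f u v : Pt d → ℝ} {η B : ℝ} (hη : 0 ≤ η)
    (hη1 : η ≤ 1 / 2) (hneg : ∀ x ∈ closure Ω, u x ≤ 0) (hB : ∀ x ∈ closure Ω, -u x ≤ B)
    (hc : M.Close f (M.interp u) v η) {y : Pt d} (hy : y ∈ M.nodes) :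
    |(M.interp u - v) y| ≤ 2 * η * B := by
  have h1 := hc.le_left y hy
  have h2 := hc.le_right y hy
  have h3 := hneg y (M.nodes_subset_closure hy)
  have h4 := hB y (M.nodes_subset_closure hy)
  rw [Pi.sub_apply]
  rw [M.interp_eq hy] at *
  have h5 : (1 + 2 * η) * u y ≤ v y := by
    refine le_of_mul_le_mul_left ?_ (show 0 < 1 - η by linarith)
    refine le_trans ?_ h1
    nlinarith [mul_nonneg (mul_nonneg hη (sub_nonneg.2 hη1)) (neg_nonneg.2 h3)]
  have h6 : η * -u y ≤ η * B := by gcongr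
  have h7 : 0 ≤ η * -u y := mul_nonneg hη (by linarith)
  rw [abs_le]
  constructor <;> linarith

end NodalMesh

end OlikerPrussner

namespace OlikerPrussner

/-! ### Dyadic summation down to level h² -/

lemma exists_dyadic_exponent {h : ℝ} (hh : 0 < h) (hh1 : h ≤ 1 / 2) :
    ∃ N : ℕ, (1 / 2 : ℝ) ^ N ≤ h ^ 2 ∧ (N : ℝ) ≤ 6 * |Real.log h| ∧ 1 / 2 ≤ |Real.log h| := by
  have hl2 : 1 / 2 < Real.log 2 := by linarith [Real.log_two_gt_d9]
  have hlog : Real.log h ≤ -Real.log 2 := by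
    rw [← Real.log_inv]
    exact Real.log_le_log hh (by linarith)
  have habs : |Real.log h| = -Real.log h := abs_of_neg (by linarith)
  rw [habs]
  -- The least N with 2^(-N) ≤ h². Since log 2 > 1/2 it is at most 4|log h| + 1, and 1 ≤ 2|log h|.
  refine ⟨⌈2 * -Real.log h / Real.log 2⌉₊, ?_, ?_, by linarith⟩
  · rw [← Real.log_le_log_iff (by positivity) (by positivity), Real.log_pow, Real.log_pow, one_div,
      Real.log_inv]
    have := Nat.le_ceil (2 * -Real.log h / Real.log 2)
    rw [div_le_iff₀ (by linarith)] at this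
    push_cast
    linarith
  · have h1 := (Nat.ceil_lt_add_one (a := 2 * -Real.log h / Real.log 2)
      (div_nonneg (by linarith) (by linarith))).le
    have h2 : 2 * -Real.log h / Real.log 2 ≤ 4 * -Real.log h := by
      rw [div_le_iff₀ (by linarith)]
      nlinarith
    linarith

/-- A weak-type bound of order `h²` gives bounds for the sums of `p`-th powers. -/
lemma sum_mul_rpow_le_of_weak {ι : Type*} (s : Finset ι) {f a : ι → ℝ} {F C B p h : ℝ}
    (hf : ∀ i ∈ s, 0 ≤ f i) (hF : ∑ i ∈ s, f i ≤ F) (hF0 : 0 ≤ F) (ha : ∀ i ∈ s, 0 ≤ a i)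
    (haC : ∀ i ∈ s, a i ≤ C) (hC : 0 < C) (hB : 0 ≤ B) (hp : 1 ≤ p) (hh : 0 < h) (hh1 : h ≤ 1 / 2)
    (hweak : ∀ t, 0 < t → ∑ i ∈ s with t < a i, f i ≤ B * h ^ 2 / t) :
    (p = 1 → ∑ i ∈ s, f i * a i ^ p ≤ (2 * F * C + 12 * B) * (h ^ 2 * |Real.log h|)) ∧
    (1 < p → ∑ i ∈ s, f i * a i ^ p ≤
      (F * C ^ p + 2 * B * C ^ (p - 1) / (1 - (1 / 2) ^ (p - 1))) * h ^ 2) := by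
  obtain ⟨N, hN, hNlog, hlog⟩ := exists_dyadic_exponent hh hh1
  have key := sum_mul_rpow_le s hf hF ha haC hC (by linarith : 0 ≤ p) hweak N
  -- The ratio between consecutive levels is 2^(-(p-1)): it equals 1 for p = 1, so the number N of
  -- levels enters, and is below 1 for p > 1.
  have hterm : ∀ k : ℕ, (C * (1 / 2) ^ k) ^ p * (B * h ^ 2 / (C * (1 / 2) ^ (k + 1))) =
      2 * B * h ^ 2 * C ^ (p - 1) * ((1 / 2) ^ (p - 1)) ^ k := by
    intro k
    have h1 : ((1 / 2 : ℝ) ^ (p - 1)) ^ k = ((1 / 2 : ℝ) ^ k) ^ (p - 1) := by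
      rw [← Real.rpow_natCast, ← Real.rpow_natCast, ← Real.rpow_mul (by norm_num),
        ← Real.rpow_mul (by norm_num), mul_comm]
    rw [h1, mul_assoc, ← Real.mul_rpow hC.le (by positivity), Real.rpow_sub_one (by positivity),
      pow_succ]
    field_simp
    ring
  simp_rw [hterm, ← Finset.mul_sum] at key
  constructor
  · rintro rfl
    simp only [sub_self, Real.rpow_zero, one_pow, Finset.sum_const, Finset.card_range, nsmul_eq_mul,
      mul_one, Real.rpow_one] at key ⊢
    refine key.trans ?_
    have hh2 : 0 ≤ h ^ 2 := by positivity
    have h1 : F * (C * (1 / 2) ^ N) ≤ F * (C * h ^ 2) := by gcongr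
    have h2 : F * (C * h ^ 2) * 1 ≤ F * (C * h ^ 2) * (2 * |Real.log h|) := by
      gcongr; linarith
    have h3 : 2 * B * h ^ 2 * N ≤ 2 * B * h ^ 2 * (6 * |Real.log h|) := by gcongr
    linarith
  · intro hp1
    refine key.trans ?_
    set r : ℝ := (1 / 2) ^ (p - 1) with hr
    have hr0 : 0 ≤ r := by positivity
    have hr1 : r < 1 := Real.rpow_lt_one (by norm_num) (by norm_num) (by linarith)
    have hgeom : ∑ k ∈ Finset.range N, r ^ k ≤ (1 - r)⁻¹ := by
      rw [← tsum_geometric_of_lt_one hr0 hr1]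
      exact (summable_geometric_of_lt_one hr0 hr1).sum_le_tsum _ fun k _ => by positivity
    have hN1 : (1 / 2 : ℝ) ^ N ≤ 1 := pow_le_one₀ (by norm_num) (by norm_num)
    have h1 : ((1 / 2 : ℝ) ^ N) ^ p ≤ h ^ 2 :=
      (Real.rpow_le_self_of_le_one (by positivity) hN1 hp).trans hN
    have h2 : F * (C * (1 / 2) ^ N) ^ p ≤ F * (C ^ p * h ^ 2) := by
      rw [Real.mul_rpow hC.le (by positivity)]
      gcongr
    have h3 : 2 * B * h ^ 2 * C ^ (p - 1) * ∑ k ∈ Finset.range N, r ^ k ≤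
        2 * B * h ^ 2 * C ^ (p - 1) * (1 - r)⁻¹ := by gcongr
    refine (add_le_add h2 h3).trans (le_of_eq ?_)
    rw [div_eq_mul_inv]
    ring

lemma NodalMesh.w2pNorm_eq_zero {d : ℕ} {Ω : Set (Pt d)} {h : ℝ} (M : NodalMesh d Ω h)
    (hM : M.interior = ∅) (f : Pt d → ℝ) (e : Fin d → ℤ) {p : ℝ} (hp : 1 ≤ p) (v : Pt d → ℝ) :
    M.w2pNorm f e p v = 0 := by
  rw [NodalMesh.w2pNorm, hM, Finset.sum_empty, Real.zero_rpow]
  positivity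

end OlikerPrussner

/-! ### Choice of constants and conclusion -/

open OlikerPrussner in
theorem mainTheorem2 (d : ℕ) (Ω : Set (OlikerPrussner.Pt d)) (hΩo : IsOpen Ω)
    (hΩb : Bornology.IsBounded Ω) (hΩc : Convex ℝ Ω)
    (f u : OlikerPrussner.Pt d → ℝ) (hf : ContinuousOn f (closure Ω))
    (hfpos : ∃ c : ℝ, 0 < c ∧ ∀ x ∈ Ω, c ≤ f x)
    (hu : OlikerPrussner.IsMongeAmpereSolution Ω f u) (hureg : OlikerPrussner.IsC11 Ω u)
    (σ C₀ p : ℝ) (hp : 1 ≤ p) :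
    ∃ C h₀ : ℝ, 0 < h₀ ∧ ∀ h : ℝ, 0 < h → h < h₀ →
      ∀ M : OlikerPrussner.NodalMesh d Ω h, M.ShapeRegular σ →
        M.ConsistencyLE f u (C₀ * h ^ (2 + d)) →
        ∀ u_h : OlikerPrussner.Pt d → ℝ, M.IsSolution f u_h →
        ∀ e : Fin d → ℤ, e ≠ 0 →
          (p = 1 → M.w2pNorm f e p (M.interp u - u_h) ≤ C * (h ^ 2 * |Real.log h|)) ∧
          (1 < p → M.w2pNorm f e p (M.interp u - u_h) ≤ C * h ^ (2 / p)) := by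
  rcases eq_or_ne d 0 with rfl | hd
  · exact ⟨0, 1, one_pos, fun _ _ _ _ _ _ _ _ e he => absurd (Subsingleton.elim e 0) he⟩
  rcases Ω.eq_empty_or_nonempty with rfl | hne
  · refine ⟨0, 1, one_pos, fun h _ _ M _ _ u_h _ e _ => ?_⟩
    have hM : M.interior = ∅ := Finset.eq_empty_of_forall_notMem fun z hz => M.interior_mem z hz
    simp [M.w2pNorm_eq_zero hM f e hp]
  obtain ⟨c, hc, hfc⟩ := hfpos
  obtain ⟨x₀, hx₀, hux₀⟩ := hu.exists_neg hd hΩo hΩb hc hfc hne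
  obtain ⟨K, L, hK, hL, hTΩ⟩ := hasTangents_of_isC11 hΩo hΩb hΩc hu.convexOn hureg
  have hT := hasTangents_closure hu.continuousOn hTΩ
  have hu0 := hu.boundary
  have hneg : ∀ x ∈ closure Ω, u x ≤ 0 := fun x hx =>
    nonpos_of_convexOn hd hΩo hΩb hu.convexOn hu0 hx
  obtain ⟨D, hD0, hD⟩ : ∃ D : ℝ, 0 < D ∧ ∀ x ∈ closure Ω, ∀ y ∈ closure Ω, ‖x - y‖ ≤ D := by
    obtain ⟨D, hD⟩ := Metric.isBounded_iff.1 hΩb.closure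
    refine ⟨max D 1, by positivity, fun x hx y hy => ?_⟩
    rw [← dist_eq_norm]
    exact (hD hx hy).trans (le_max_left _ _)
  set A := K * D / (-u x₀) with hAdef
  have hA0 : 0 ≤ A := div_nonneg (by positivity) (by linarith)
  have hA : ∀ y ∈ frontier Ω, ∀ q : Pt d, (∀ x ∈ closure Ω, (inner ℝ q x : ℝ) ≤ inner ℝ q y) →
      ∀ z ∈ frontier Ω, inner ℝ q (y - z) ≤ A * ‖q‖ * ‖y - z‖ ^ 2 := fun y hy q hq z hz =>
    hT.inner_le hΩo hΩc hD0 hD hK hu0 hx₀ hux₀ hy hq hz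
  have hB : ∀ x ∈ closure Ω, -u x ≤ -u x₀ + L * D := fun x hx => by
    have h1 := hT.sub_le (subset_closure hx₀) hx
    have h2 : L * ‖x - x₀‖ ≤ L * D := by gcongr; exact hD x hx x₀ (subset_closure hx₀)
    linarith
  set B := -u x₀ + L * D with hBdef
  have hB0 : 0 < B := add_pos (neg_pos.2 hux₀) (by positivity)
  -- An arbitrary real σ is replaced by one that is at least 1, as the ball radius h/(16σ') requires
  -- a positive constant.
  set σ' := max σ 1
  have : Nonempty (Fin d) := ⟨⟨0, Nat.pos_of_ne_zero hd⟩⟩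
  set c₁ := c / 2 * (volume (Metric.ball (0 : Pt d) 1)).toReal / (16 * σ') ^ d with hc₁def
  have hc₁ : 0 < c₁ := by
    have : 0 < (volume (Metric.ball (0 : Pt d) 1)).toReal :=
      ENNReal.toReal_pos (Metric.measure_ball_pos _ _ one_pos).ne' measure_ball_lt_top.ne
    have : 0 < σ' := lt_max_of_lt_right one_pos
    positivity
  set κ := |C₀| / c₁ + 1 with hκ
  have hκ0 : 0 < κ := by positivity
  set F := (volume (Metric.closedBall (0 : Pt d) (2 * 2 * L))).toReal
  have hF0 : 0 ≤ F := ENNReal.toReal_nonneg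
  -- The nodal error is at most 2κh²B, and δ_e multiplies a sup bound by at most 16/h².
  set C₁ := 32 * κ * B with hC₁
  have hC₁0 : 0 < C₁ := by positivity
  set G := 10 * (d + 2) * F * (2 * K + C₁ + 48 * L * A) * κ with hG
  have hG0 : 0 ≤ G := by positivity
  set P := F * C₁ ^ p + 2 * G * C₁ ^ (p - 1) / (1 - (1 / 2) ^ (p - 1)) with hP
  refine ⟨max (2 * F * C₁ + 12 * G) (P ^ (1 / p)),
    min (1 / 2) (min (1 / (4 * (A + 1))) (1 / (2 * κ))), by positivity,
    fun h hh hlt M hM hcons u_h hsol e he => ?_⟩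
  rw [lt_min_iff, lt_min_iff] at hlt
  obtain ⟨hh1, hh2, hh3⟩ := hlt
  have hAh : A * h ≤ 1 / 4 := by
    rw [lt_div_iff₀ (by positivity)] at hh2
    linarith
  have hηh : κ * h ^ 2 ≤ 1 / 2 := by
    rw [lt_div_iff₀ (by positivity)] at hh3
    nlinarith [mul_pos hκ0 hh]
  have hM' : M.ShapeRegular σ' := fun s hs hcard => (hM s hs hcard).trans (by
    refine mul_le_mul_of_nonneg_right (le_max_left _ _) ?_
    by_cases hbdd : BddAbove {t : ℝ | ∃ c : Pt d, Metric.ball c (t / 2) ⊆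
        convexHull ℝ (s : Set (Pt d))}
    · exact le_csSup hbdd ⟨0, by simp⟩
    -- An unbounded real set has supremum 0 by convention, so nonnegativity holds in either case.
    · exact (Real.sSup_of_not_bddAbove hbdd).ge)
  have hclose := M.close_of_consistency hd hu0 hh hc₁
    (fun z hz => M.le_load hd hh hΩo hΩb hΩc (le_max_right _ _) hM' hf hc.le hfc hz) hcons hsol hηh
  have hη0 : 0 ≤ κ * h ^ 2 := by positivity
  have hsum := hclose.sum_load_le hh hd hΩo hΩb hL.le hA0 hT hu0 hneg hA hAh hηh
  have hbd : ∀ z ∈ M.interior, |M.secondDiff e (M.interp u - u_h) z| ≤ C₁ := fun z hz => by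
    have := M.abs_secondDiff_le hh hΩo hΩb hz he fun y hy =>
      hclose.abs_sub_le hη0 hηh hneg hB hy
    refine this.trans (le_of_eq ?_)
    rw [hC₁]
    field_simp
    ring
  obtain ⟨e1, e2⟩ := sum_mul_rpow_le_of_weak (B := G) (p := p) M.interior
    (f := M.load f) (a := fun z => |M.secondDiff e (M.interp u - u_h) z|)
    (fun z hz => (hclose.load_pos z hz).le) hsum hF0 (fun _ _ => abs_nonneg _) hbd hC₁0 hG0 hp hh
    hh1.le fun t ht => by
      have := hclose.sum_level_le hh hd hΩo hΩb hK hL.le hA0 hT hu0 hneg hA hAh hη0 hηh he hbd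
        hC₁0.le hsum ht
      rwa [← mul_assoc] at this
  constructor
  · intro hp1
    have h1 := e1 hp1
    rw [NodalMesh.w2pNorm, show 1 / p = 1 by rw [hp1, div_one], Real.rpow_one]
    exact h1.trans (mul_le_mul_of_nonneg_right (le_max_left _ _) (by positivity))
  · intro hp1
    have hr1 : (1 / 2 : ℝ) ^ (p - 1) < 1 :=
      Real.rpow_lt_one (by norm_num) (by norm_num) (by linarith)
    have hP0 : 0 ≤ P := add_nonneg (by positivity) (div_nonneg (by positivity) (by linarith))
    have h1 := Real.rpow_le_rpow (Finset.sum_nonneg fun z hz => mul_nonneg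
      (hclose.load_pos z hz).le (by positivity)) (e2 hp1) (by positivity : 0 ≤ 1 / p)
    rw [NodalMesh.w2pNorm]
    refine h1.trans ?_
    rw [Real.mul_rpow hP0 (by positivity), ← Real.rpow_natCast, ← Real.rpow_mul hh.le,
      Nat.cast_ofNat, mul_one_div]
    exact mul_le_mul_of_nonneg_right (le_max_right _ _) (by positivity)
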